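/- **Conventions.** Let $\mathbb{A}$ be a small category. A *module* $M:\mathbb{A}\to\mathbb{A}$ is a functor $M:\mathbb{A}^{\mathrm{op}}\times\mathbb{A}\to\mathbf{Set}$; for $m\in M(b,a)$ (a *sector*, written $m:b\rightsquigarrow a$), $f:a\to a'$ and $g:b'\to b$, write $fm\in M(b,a')$ and $mg\in M(b',a)$ for the actions. For $Y:\mathbb{A}^{\mathrm{op}}\to\mathbf{Set}$ and $X:\mathbb{A}\to\mathbf{Set}$ put $Y\otimes X=\bigl(\sum_{b}Y(b)\times X(b)\bigr)/\!\sim$, where $\sim$ is the equivalence relation generated by $(yg,x)\sim(y,gx)$ for $g:b'\to b$, $y\in Y(b)$, $x\in X(b')$. If $X$ takes values in $\mathbf{Top}$ (all topological spaces and continuous maps), $Y\otimes X$ is given the quotient topology, each $Y(b)$ being discrete. Put $(M\otimes X)(a)=M(-,a)\otimes X$. Let $U:\mathbf{Top}\to\mathbf{Set}$ be the underlying-set functor. A functor $X:\mathbb{A}\to\mathbf{Set}$ is *nondegenerate* if $-\otimes X:[\mathbb{A}^{\mathrm{op}},\mathbf{Set}]\to\mathbf{Set}$ preserves finite connected limits;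 a functor $X:\mathbb{A}\to\mathbf{Top}$ is *nondegenerate* if $U\circ X$ is nondegenerate and $Xf$ is a closed map for every map $f$ of $\mathbb{A}$. The module $M$ is *nondegenerate* if each $M(b,-)$ is nondegenerate, and *finite* if for each $a$ the category of elements of $M(-,a)$ is finite (has finitely many objects and maps). An *equational system* $(\mathbb{A},M)$ is a small category $\mathbb{A}$ with a finite nondegenerate module $M:\mathbb{A}\to\mathbb{A}$. An *$M$-coalgebra in $\mathbf{Set}$* (respectively, $\mathbf{Top}$) is a nondegenerate functor $X$ from $\mathbb{A}$ to $\mathbf{Set}$ (respectively, $\mathbf{Top}$) with a natural transformation $\xi:X\to M\otimes X$; a map $(X,\xi)\to(X',\xi')$ is a natural transformation $\alpha:X\to X'$ with $\xi'\alpha=(M\otimes\alpha)\xi$. A *universal solution* of $(\mathbb{A},M)$ in $\mathbf{Set}$ (respectively, $\mathbf{Top}$) is a terminal object of the category of $M$-coalgebras in $\mathbf{Set}$ (respectively, $\mathbf{Top}$). The *underlying coalgebra* in $\mathbf{Set}$ of an $M$-coalgebra $(X,\xi)$ in $\mathbf{Top}$ is $U\circ X$ with $U\circ X\xrightarrow{U\xi}U\circ(M\otimes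 X)\cong M\otimes(U\circ X)$. A *complex* $(a_\bullet,m_\bullet)$ is a sequence of objects $a_n$ $(n\ge 0)$ of $\mathbb{A}$ and sectors $m_n\in M(a_n,a_{n-1})$ $(n\ge 1)$. A *map of complexes* $f_\bullet:(a_\bullet,m_\bullet)\to(b_\bullet,p_\bullet)$ is a sequence of maps $f_n:a_n\to b_n$ in $\mathbb{A}$ $(n\ge 0)$ with $f_{n-1}m_n=p_nf_n$ for all $n\ge1$. *Condition $\mathbf{S}$* is the conjunction of: - **S1**: for all maps of complexes $f_\bullet:(a_\bullet,m_\bullet)\to(b_\bullet,p_\bullet)$ and $f'_\bullet:(a'_\bullet,m'_\bullet)\to(b_\bullet,p_\bullet)$, there exist an object $c$ and maps $g:c\to a_0$, $g':c\to a'_0$ in $\mathbb{A}$ with $f_0g=f'_0g'$; - **S2**: for all maps of complexes $f_\bullet,f'_\bullet:(a_\bullet,m_\bullet)\to(b_\bullet,p_\bullet)$, there exist an object $c$ and a map $g:c\to a_0$ in $\mathbb{A}$ with $f_0g=f'_0g$. **Theorem (Existence of universal solution).** Let $(\mathbb{A},M)$ be an equational system. The following are equivalent: 1. $(\mathbb{A},M)$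 satisfies condition $\mathbf{S}$; 2. $(\mathbb{A},M)$ has a universal solution in $\mathbf{Top}$; 3. $(\mathbb{A},M)$ has a universal solution in $\mathbf{Set}$. In that case, the universal solution in $\mathbf{Set}$ is the underlying coalgebra in $\mathbf{Set}$ of the universal solution in $\mathbf{Top}$; that is, the underlying coalgebra of any universal solution in $\mathbf{Top}$ is a universal solution in $\mathbf{Set}$. -/

import Mathlib

open CategoryTheory CategoryTheory.Limits Opposite

universe u

namespace SelfSimilarity

section Tensor

variable {A : Type u} [SmallCategory A]

/-- The sum `∑_b Y(b) × X(b)`, written as the sum of one copy of `X(b)` for each pair `(b, y)`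
with `y ∈ Y(b)`. -/
def TensorSum (Y : Aᵒᵖ ⥤ Type u) (X : A ⥤ Type u) : Type u :=
  Σ p : (Σ b : A, Y.obj (op b)), X.obj p.1

/-- The generating relation `(y g, x) ∼ (y, g x)`, for `g : b' ⟶ b`, `y ∈ Y(b)`, `x ∈ X(b')`. -/
inductive TensorRel (Y : Aᵒᵖ ⥤ Type u) (X : A ⥤ Type u) :
    TensorSum Y X → TensorSum Y X → Prop
  | glue {b' b : A} (g : b' ⟶ b) (y : Y.obj (op b)) (x : X.obj b') :
      TensorRel Y X ⟨⟨b', Y.map g.op y⟩, x⟩ ⟨⟨b, y⟩, X.map g x⟩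

/-- The tensor product (coend) `Y ⊗ X = (∑_b Y(b) × X(b)) / ∼`, where `∼` is the equivalence
relation generated by `TensorRel`. -/
def Tensor (Y : Aᵒᵖ ⥤ Type u) (X : A ⥤ Type u) : Type u :=
  Quot (TensorRel Y X)

/-- The element `y ⊗ x` of `Y ⊗ X`. -/
def tmk {Y : Aᵒᵖ ⥤ Type u} {X : A ⥤ Type u} {b : A} (y : Y.obj (op b)) (x : X.obj b) :
    Tensor Y X :=
  Quot.mk _ ⟨⟨b, y⟩, x⟩

theorem tmk_glue {Y : Aᵒᵖ ⥤ Type u} {X : A ⥤ Type u} {b' b : A} (g : b' ⟶ b)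
    (y : Y.obj (op b)) (x : X.obj b') :
    (tmk (Y.map g.op y) x : Tensor Y X) = tmk y (X.map g x) :=
  Quot.sound (TensorRel.glue g y x)

theorem Tensor.ind {Y : Aᵒᵖ ⥤ Type u} {X : A ⥤ Type u} {P : Tensor Y X → Prop}
    (h : ∀ (b : A) (y : Y.obj (op b)) (x : X.obj b), P (tmk y x)) (t : Tensor Y X) : P t :=
  Quot.ind (fun s => h s.1.1 s.1.2 s.2) t

/-- The map `φ ⊗ α : Y ⊗ X → Y' ⊗ X'`, sending `y ⊗ x` to `φ(y) ⊗ α(x)`. -/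
def Tensor.map {Y Y' : Aᵒᵖ ⥤ Type u} {X X' : A ⥤ Type u} (φ : Y ⟶ Y') (α : X ⟶ X') :
    Tensor Y X → Tensor Y' X' :=
  Quot.lift (fun s => tmk (φ.app (op s.1.1) s.1.2) (α.app s.1.1 s.2)) (by
    rintro _ _ ⟨g, y, x⟩
    dsimp only
    rw [NatTrans.naturality_apply, NatTrans.naturality_apply]
    exact tmk_glue g _ _)

@[simp]
theorem Tensor.map_tmk {Y Y' : Aᵒᵖ ⥤ Type u} {X X' : A ⥤ Type u} (φ : Y ⟶ Y') (α : X ⟶ X')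
    {b : A} (y : Y.obj (op b)) (x : X.obj b) :
    Tensor.map φ α (tmk y x) = tmk (φ.app (op b) y) (α.app b x) :=
  rfl

/-- The functor `(X, Y) ↦ Y ⊗ X`; thus `tensorSet.obj X` is the functor
`- ⊗ X : [Aᵒᵖ, Set] ⥤ Set`. -/
def tensorSet : (A ⥤ Type u) ⥤ (Aᵒᵖ ⥤ Type u) ⥤ Type u where
  obj X :=
    { obj := fun Y => Tensor Y X
      map := fun φ => TypeCat.ofHom (Tensor.map φ (𝟙 X))
      map_id := fun Y => by
        ext t
        induction t using Tensor.ind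
        simp
      map_comp := fun φ ψ => by
        ext t
        induction t using Tensor.ind
        simp }
  map α :=
    { app := fun Y => TypeCat.ofHom (Tensor.map (𝟙 Y) α)
      naturality := fun Y Y' φ => by
        ext t
        induction t using Tensor.ind
        simp }
  map_id X := by
    ext Y t
    induction t using Tensor.ind
    simp
  map_comp α β := by
    ext Y t
    induction t using Tensor.ind
    simp

/-- The underlying set-valued functor `U ∘ X` of a space-valued functor `X`. -/
abbrev underlying (X : A ⥤ TopCat.{u}) : A ⥤ Type u := X ⋙ forget TopCat.{u}

/-- For `X` with values in spaces, `∑_b Y(b) × X(b)` is the topological sum of one copy of the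
space `X(b)` for each `(b, y)`, that is, each `Y(b)` is discrete. -/
instance (Y : Aᵒᵖ ⥤ Type u) (X : A ⥤ TopCat.{u}) :
    TopologicalSpace (TensorSum Y (underlying X)) :=
  inferInstanceAs (TopologicalSpace (Σ p : (Σ b : A, Y.obj (op b)), (X.obj p.1 : Type u)))

/-- For `X` with values in spaces, `Y ⊗ X` has the quotient topology from `∑_b Y(b) × X(b)`. -/
instance (Y : Aᵒᵖ ⥤ Type u) (X : A ⥤ TopCat.{u}) :
    TopologicalSpace (Tensor Y (underlying X)) :=
  inferInstanceAs (TopologicalSpace (Quot (TensorRel Y (underlying X))))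

theorem continuous_tmk {Y : Aᵒᵖ ⥤ Type u} {X : A ⥤ TopCat.{u}} {b : A} (y : Y.obj (op b)) :
    Continuous (fun x : X.obj b => (tmk (X := underlying X) y x : Tensor Y (underlying X))) :=
  (continuous_quot_mk (X := TensorSum Y (underlying X))).comp
    (continuous_sigmaMk (σ := fun p : (Σ b : A, Y.obj (op b)) => (X.obj p.1 : Type u)) (i := ⟨b, y⟩))

theorem continuous_of_comp_tmk {Y : Aᵒᵖ ⥤ Type u} {X : A ⥤ TopCat.{u}} {Z : Type u}
    [TopologicalSpace Z] {f : Tensor Y (underlying X) → Z}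
    (hf : ∀ (b : A) (y : Y.obj (op b)),
      Continuous (fun x : X.obj b => f (tmk (X := underlying X) y x))) :
    Continuous f :=
  (isQuotientMap_quot_mk (X := TensorSum Y (underlying X))).continuous_iff.2
    (continuous_sigma (σ := fun p : (Σ b : A, Y.obj (op b)) => (X.obj p.1 : Type u))
      fun p => hf p.1 p.2)

theorem Tensor.continuous_map {Y Y' : Aᵒᵖ ⥤ Type u} {X X' : A ⥤ TopCat.{u}} (φ : Y ⟶ Y')
    (α : X ⟶ X') :
    Continuous (Tensor.map φ (Functor.whiskerRight α (forget TopCat.{u})) :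
      Tensor Y (underlying X) → Tensor Y' (underlying X')) :=
  continuous_of_comp_tmk fun b y =>
    (continuous_tmk (X := X') (φ.app (op b) y)).comp (α.app b).hom.continuous

/-- The functor `(X, Y) ↦ Y ⊗ X` for `X` with values in spaces. -/
def tensorTop : (A ⥤ TopCat.{u}) ⥤ (Aᵒᵖ ⥤ Type u) ⥤ TopCat.{u} where
  obj X :=
    { obj := fun Y => TopCat.of (Tensor Y (underlying X))
      map := fun φ => TopCat.ofHom ⟨_, Tensor.continuous_map φ (𝟙 X)⟩
      map_id := fun Y => by
        ext t
        induction t using Tensor.ind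
        simp
      map_comp := fun φ ψ => by
        ext t
        induction t using Tensor.ind
        simp }
  map α :=
    { app := fun Y => TopCat.ofHom ⟨_, Tensor.continuous_map (𝟙 Y) α⟩
      naturality := fun Y Y' φ => by
        ext t
        induction t using Tensor.ind
        simp }
  map_id X := by
    ext Y t
    induction t using Tensor.ind
    simp
  map_comp α β := by
    ext Y t
    induction t using Tensor.ind
    simp

end Tensor

section Nondegenerate

variable {A : Type u} [SmallCategory A]

/-- `X : A ⥤ Set` is nondegenerate if `- ⊗ X : [Aᵒᵖ, Set] ⥤ Set` preserves finite connected
limits. (A connected category is nonempty.) -/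
def NondegenerateSet (X : A ⥤ Type u) : Prop :=
  ∀ (J : Type) [SmallCategory J] [FinCategory J] [IsConnected J],
    PreservesLimitsOfShape J (tensorSet.obj X)

/-- `X : A ⥤ Top` is nondegenerate if `U ∘ X` is nondegenerate and each map `X f` is closed. -/
def NondegenerateTop (X : A ⥤ TopCat.{u}) : Prop :=
  NondegenerateSet (underlying X) ∧ ∀ ⦃a a' : A⦄ (f : a ⟶ a'), IsClosedMap (X.map f)

/-- A presheaf is finite if its category of elements has finitely many objects and finitely many
morphisms. (Mathlib's `Y.Elements` is the opposite of the category of elements with arrows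
`(b, y) ⟶ (b', y')` the maps `g : b ⟶ b'` such that `y' g = y`; this does not affect finiteness.) -/
def FinitePresheaf (Y : Aᵒᵖ ⥤ Type u) : Prop :=
  Finite Y.Elements ∧ ∀ p q : Y.Elements, Finite (p ⟶ q)

end Nondegenerate

section EquationalSystem

variable {A : Type u} [SmallCategory A]

/-- A module `M : A ⇸ A`, i.e. a functor `Aᵒᵖ × A ⥤ Set`, is given here in curried form
`M : A ⥤ Aᵒᵖ ⥤ Set`. The elements of `M(b, a)` are the sectors `m : b ⇸ a`. -/
abbrev Sector (M : Profunctor.{u} A A) (b a : A) : Type u := (M.obj a).obj (op b)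

/-- The sector `f m : b ⇸ a'`, for `m : b ⇸ a` and `f : a ⟶ a'`. -/
def Sector.push {M : Profunctor.{u} A A} {b a a' : A} (m : Sector M b a) (f : a ⟶ a') :
    Sector M b a' :=
  (M.map f).app (op b) m

/-- The sector `m g : b' ⇸ a`, for `g : b' ⟶ b` and `m : b ⇸ a`. -/
def Sector.pull {M : Profunctor.{u} A A} {b' b a : A} (g : b' ⟶ b) (m : Sector M b a) :
    Sector M b' a :=
  (M.obj a).map g.op m

/-- `(A, M)` is an equational system: each presheaf `M(-, a)` is finite and each functor
`M(b, -)` is nondegenerate. -/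
structure IsEquationalSystem (M : Profunctor.{u} A A) : Prop where
  finite : ∀ a : A, FinitePresheaf (M.obj a)
  nondegenerate : ∀ b : A, NondegenerateSet (M.flip.obj (op b))

/-- The endofunctor `M ⊗ -` of `[A, Set]`, with `(M ⊗ X)(a) = M(-, a) ⊗ X`. -/
def modTensorSet (M : Profunctor.{u} A A) : (A ⥤ Type u) ⥤ (A ⥤ Type u) :=
  tensorSet ⋙ (Functor.whiskeringLeft A (Aᵒᵖ ⥤ Type u) (Type u)).obj M

/-- The endofunctor `M ⊗ -` of `[A, Top]`, with `(M ⊗ X)(a) = M(-, a) ⊗ X`. -/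
def modTensorTop (M : Profunctor.{u} A A) : (A ⥤ TopCat.{u}) ⥤ (A ⥤ TopCat.{u}) :=
  tensorTop ⋙ (Functor.whiskeringLeft A (Aᵒᵖ ⥤ Type u) TopCat.{u}).obj M

/-- The category of `M`-coalgebras in `Set`: pairs `(X, ξ : X ⟶ M ⊗ X)` with `X` nondegenerate,
and all coalgebra maps between them. Since the nondegenerate functors form a full subcategory,
these are exactly the coalgebras for the restriction of `M ⊗ -` to it. -/
abbrev CoalgSet (M : Profunctor.{u} A A) : Type (u + 1) :=
  ObjectProperty.FullSubcategory
    (fun C : Endofunctor.Coalgebra (modTensorSet M) => NondegenerateSet C.V)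

/-- The category of `M`-coalgebras in `Top`. -/
abbrev CoalgTop (M : Profunctor.{u} A A) : Type (u + 1) :=
  ObjectProperty.FullSubcategory
    (fun C : Endofunctor.Coalgebra (modTensorTop M) => NondegenerateTop C.V)

/-- The canonical isomorphism `U ∘ (M ⊗ X) ≅ M ⊗ (U ∘ X)`; its components are identities. -/
def underlyingModTensor (M : Profunctor.{u} A A) (X : A ⥤ TopCat.{u}) :
    underlying ((modTensorTop M).obj X) ≅ (modTensorSet M).obj (underlying X) :=
  NatIso.ofComponents (fun a => Iso.refl (Tensor (M.obj a) (underlying X))) (by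
    intro a a' f
    ext t
    induction t using Tensor.ind
    rfl)

/-- The forgetful functor `U_*` from `M`-coalgebras in `Top` to `M`-coalgebras in `Set`, sending
`(X, ξ)` to `U ∘ X` with structure map `U ∘ X ⟶ U ∘ (M ⊗ X) ≅ M ⊗ (U ∘ X)`. -/
def forgetCoalg (M : Profunctor.{u} A A) : CoalgTop M ⥤ CoalgSet M where
  obj C :=
    { obj :=
        { V := underlying C.obj.V
          str := Functor.whiskerRight C.obj.str (forget TopCat.{u}) ≫
            (underlyingModTensor M C.obj.V).hom }
      property := C.property.1 }
  map h := ObjectProperty.homMk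
    { f := Functor.whiskerRight h.hom.f (forget TopCat.{u})
      h := by
        ext a x
        have := congrArg (fun k => k.app a x) h.hom.h
        exact this }

/-- A complex `⋯ ⇸ a₂ ⇸ a₁ ⇸ a₀`; `sector n` is `m_{n+1} : a_{n+1} ⇸ a_n`. -/
structure SectorComplex (M : Profunctor.{u} A A) where
  obj : ℕ → A
  sector : ∀ n : ℕ, Sector M (obj (n + 1)) (obj n)

/-- A map of complexes: `f_n : a_n ⟶ b_n` with `f_n m_{n+1} = p_{n+1} f_{n+1}` for all `n`. -/
structure SectorComplex.Map {M : Profunctor.{u} A A} (C D : SectorComplex M) where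
  app : ∀ n : ℕ, C.obj n ⟶ D.obj n
  comm : ∀ n : ℕ, (C.sector n).push (app n) = Sector.pull (app (n + 1)) (D.sector n)

/-- Condition S1: for maps of complexes `f : a ⟶ b` and `f' : a' ⟶ b`, the cospan
`a₀ ⟶ b₀ ⟵ a'₀` can be completed to a commutative square. -/
def SolvableS1 (M : Profunctor.{u} A A) : Prop :=
  ∀ (C C' D : SectorComplex M) (f : C.Map D) (f' : C'.Map D),
    ∃ (c : A) (g : c ⟶ C.obj 0) (g' : c ⟶ C'.obj 0), g ≫ f.app 0 = g' ≫ f'.app 0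

/-- Condition S2: for parallel maps of complexes `f, f' : a ⟶ b`, the pair
`f₀, f'₀ : a₀ ⟶ b₀` can be extended to a fork. -/
def SolvableS2 (M : Profunctor.{u} A A) : Prop :=
  ∀ (C D : SectorComplex M) (f f' : C.Map D),
    ∃ (c : A) (g : c ⟶ C.obj 0), g ≫ f.app 0 = g ≫ f'.app 0

/-- The solvability condition S. -/
def Solvable (M : Profunctor.{u} A A) : Prop :=
  SolvableS1 M ∧ SolvableS2 M

/-- `(A, M)` has a universal solution in `Set`: a terminal `M`-coalgebra in `Set`. -/
def HasUniversalSolutionSet (M : Profunctor.{u} A A) : Prop :=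
  ∃ J : CoalgSet M, Nonempty (IsTerminal J)

/-- `(A, M)` has a universal solution in `Top`: a terminal `M`-coalgebra in `Top`. -/
def HasUniversalSolutionTop (M : Profunctor.{u} A A) : Prop :=
  ∃ I : CoalgTop M, Nonempty (IsTerminal I)

end EquationalSystem

end SelfSimilarity

/-!
# Universal solutions of equational systems

*Nondegeneracy.* A functor `X : A ⥤ Set` is nondegenerate if and only if every connected component
of its category of elements is cofiltered (`NondegenerateSet.isComponentwiseFlat`,
`IsComponentwiseFlat.nondegenerateSet`). In that case `y ⊗ x = y' ⊗ x'` if and only if a single span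
identifies the two (`IsComponentwiseFlat.tmk_eq_iff`), and this is what makes tensor products
computable below.

*Sufficiency of S.* The candidate `I = solution M` is the colimit of the representables `A(C₀, -)`
over all complexes `C`. Conditions S1 and S2 concern single objects, but since `M` is nondegenerate
the squares and forks they provide in each degree propagate to lower degrees, and since `M` is finite
König's lemma selects a compatible family of them (`SectorComplex.exists_square`,
`SectorComplex.exists_fork`). So the category of complexes has cospans completing to squares and
parallel pairs extending to forks, which makes `I` nondegenerate. Splitting off the first sector is
a bijection `I ≅ M ⊗ I`.

Iterating the structure map of a coalgebra resolves each element by a complex; any two resolutions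
are connected by a span, so there is a coalgebra map `classify` to `I`. It is the only one because a
point of `I` is determined by the initial segments of its resolutions. More precisely, let the
cylinder of a truncated complex consist of the elements that have a resolution starting with it. Two
infinite complexes whose cylinders of every length meet represent the same point
(`Truncated.eq_of_cylinders_meet`), again by König's lemma.

*Topology.* A point of `I(a)` is in the closure of `S` when for every `n` some cylinder of length `n`
contains the point and meets `S`. Maps that carry cylinders to cylinders are continuous;
by compactness and the separation property they are also closed (`CarriesCylinders.isClosedMap`).
This applies to the maps `I f` and to the action of sectors on `I`, hence `I` is nondegenerate in
`Top` and its structure map is continuous. In a coalgebra in `Top` the cylinders are closed and there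
are finitely many of each length, so `classify` is continuous. Thus `I` is terminal in `Top`.

*From `Top` to `Set`.* The forgetful functor on coalgebras has a left adjoint, the discrete topology,
so it preserves terminal objects.

*Necessity of S.* A complex `C` makes `∑ₙ A(Cₙ, -)` a coalgebra, contravariantly in `C`. The generator
in degree `0` therefore gives each complex a point of a terminal coalgebra `J` in `Set`, naturally in
the complex, and S follows from the nondegeneracy of `J`.
-/

namespace SelfSimilarity

/-! ### Nondegenerate functors in elementary terms -/

section Elementary

variable {A : Type u} [SmallCategory A]

/-- Two elements of `X` are linked when they are both images of a third one. -/
def Linked (X : A ⥤ Type u) {b b' : A} (x : X.obj b) (x' : X.obj b') : Prop :=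
  ∃ (c : A) (g : c ⟶ b) (g' : c ⟶ b') (z : X.obj c), X.map g z = x ∧ X.map g' z = x'

/-- The elementary form of nondegeneracy: elements identified by a cospan come from a commutative
square, and an element equalizing a parallel pair comes from a fork. Equivalently, each connected
component of the category of elements of `X` is cofiltered. -/
structure IsComponentwiseFlat (X : A ⥤ Type u) : Prop where
  square : ∀ {a a' b : A} (f : a ⟶ b) (f' : a' ⟶ b) (x : X.obj a) (x' : X.obj a'),
    X.map f x = X.map f' x' →
      ∃ (c : A) (g : c ⟶ a) (g' : c ⟶ a') (z : X.obj c),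
        g ≫ f = g' ≫ f' ∧ X.map g z = x ∧ X.map g' z = x'
  fork : ∀ {a b : A} (f f' : a ⟶ b) (x : X.obj a), X.map f x = X.map f' x →
      ∃ (c : A) (g : c ⟶ a) (z : X.obj c), g ≫ f = g ≫ f' ∧ X.map g z = x

theorem Linked.refl {X : A ⥤ Type u} {b : A} (x : X.obj b) : Linked X x x :=
  ⟨b, 𝟙 b, 𝟙 b, x, by simp, by simp⟩

theorem Linked.symm {X : A ⥤ Type u} {b b' : A} {x : X.obj b} {x' : X.obj b'}
    (h : Linked X x x') : Linked X x' x := by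
  obtain ⟨c, g, g', z, h, h'⟩ := h
  exact ⟨c, g', g, z, h', h⟩

theorem Linked.of_map {X : A ⥤ Type u} {b b' : A} (g : b ⟶ b') (x : X.obj b) :
    Linked X x (X.map g x) :=
  ⟨b, 𝟙 b, g, x, by simp, rfl⟩

theorem IsComponentwiseFlat.linked_trans {X : A ⥤ Type u} (hX : IsComponentwiseFlat X)
    {b b' b'' : A} {x : X.obj b} {x' : X.obj b'} {x'' : X.obj b''}
    (h : Linked X x x') (h' : Linked X x' x'') : Linked X x x'' := by
  obtain ⟨c, g, g', z, rfl, rfl⟩ := h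
  obtain ⟨d, k, k', w, e, rfl⟩ := h'
  obtain ⟨p, q, q', v, -, rfl, rfl⟩ := hX.square g' k z w e.symm
  exact ⟨p, q ≫ g, q' ≫ k', v, by simp, by simp⟩

/-- In a tensor product with a componentwise flat functor, two elements `y ⊗ x` and `y' ⊗ x'`
agree as soon as they are identified by a single span, not just by a zigzag. -/
theorem IsComponentwiseFlat.tmk_eq_iff {X : A ⥤ Type u} (hX : IsComponentwiseFlat X)
    {Y : Aᵒᵖ ⥤ Type u} {b b' : A} (y : Y.obj (op b)) (x : X.obj b)
    (y' : Y.obj (op b')) (x' : X.obj b') :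
    (tmk y x : Tensor Y X) = tmk y' x' ↔
      ∃ (c : A) (g : c ⟶ b) (g' : c ⟶ b') (z : X.obj c),
        X.map g z = x ∧ X.map g' z = x' ∧ Y.map g.op y = Y.map g'.op y' := by
  constructor
  · intro h
    let R : TensorSum Y X → TensorSum Y X → Prop := fun s t =>
      ∃ (c : A) (g : c ⟶ s.1.1) (g' : c ⟶ t.1.1) (z : X.obj c),
        X.map g z = s.2 ∧ X.map g' z = t.2 ∧ Y.map g.op s.1.2 = Y.map g'.op t.1.2
    have key : ∀ s t, Relation.EqvGen (TensorRel Y X) s t → R s t := by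
      intro s t hst
      induction hst with
      | rel s t hst =>
        obtain ⟨g, y, x⟩ := hst
        exact ⟨_, 𝟙 _, g, x, by simp, rfl, by simp⟩
      | refl s => exact ⟨_, 𝟙 _, 𝟙 _, s.2, by simp, by simp, rfl⟩
      | symm s t _ ih =>
        obtain ⟨c, g, g', z, h1, h2, h3⟩ := ih
        exact ⟨c, g', g, z, h2, h1, h3.symm⟩
      | trans s t r _ _ ih ih' =>
        obtain ⟨c, g, g', z, h1, h2, h3⟩ := ih
        obtain ⟨d, k, k', w, h4, h5, h6⟩ := ih'
        obtain ⟨p, q, q', v, e, rfl, rfl⟩ := hX.square g' k z w (h2.trans h4.symm)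
        refine ⟨p, q ≫ g, q' ≫ k', v, by simpa using h1, by simpa using h5, ?_⟩
        simp only [op_comp, Functor.map_comp, types_comp_apply]
        rw [h3, ← h6, ← types_comp_apply (Y.map g'.op), ← types_comp_apply (Y.map k.op),
          ← Functor.map_comp, ← Functor.map_comp, ← op_comp, ← op_comp, e]
    exact key _ _ (Quot.eqvGen_exact h)
  · rintro ⟨c, g, g', z, rfl, rfl, h⟩
    rw [← tmk_glue, ← tmk_glue, h]

theorem tensorSet_map_tmk (X : A ⥤ Type u) {Y Y' : Aᵒᵖ ⥤ Type u} (φ : Y ⟶ Y') {b : A}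
    (y : Y.obj (op b)) (x : X.obj b) :
    (tensorSet.obj X).map φ (tmk y x) = tmk (φ.app (op b) y) x := rfl

/-- Evaluation `A(-, a) ⊗ X ⟶ X(a)`, sending `g ⊗ x` to `g x`. -/
def yonedaEval (X : A ⥤ Type u) (a : A) : Tensor (yoneda.obj a) X → X.obj a :=
  Quot.lift (fun s => X.map (show s.1.1 ⟶ a from s.1.2) s.2) (by
    rintro _ _ ⟨g, y, x⟩
    exact X.map_comp_apply g (show _ ⟶ a from y) x)

theorem yonedaEval_tmk (X : A ⥤ Type u) {a b : A} (g : b ⟶ a) (x : X.obj b) :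
    yonedaEval X a (tmk (Y := yoneda.obj a) g x) = X.map g x := rfl

/-- Nondegeneracy, applied to pullbacks and equalizers of representable presheaves. -/
theorem NondegenerateSet.isComponentwiseFlat {X : A ⥤ Type u} (hX : NondegenerateSet X) :
    IsComponentwiseFlat X where
  square := by
    intro a a' b f f' x x' h
    have := hX WalkingCospan
    have hp := (IsPullback.of_hasPullback (yoneda.map f) (yoneda.map f')).map (tensorSet.obj X)
    obtain ⟨t, h1, h2⟩ := Types.exists_of_isPullback hp
      (tmk (Y := yoneda.obj a) (𝟙 a) x) (tmk (Y := yoneda.obj a') (𝟙 a') x') (by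
        have e : (tmk (Y := yoneda.obj b) f x : Tensor (yoneda.obj b) X)
            = tmk (Y := yoneda.obj b) f' x' := by
          have e1 := tmk_glue (Y := yoneda.obj b) (X := X) f (𝟙 b) x
          have e2 := tmk_glue (Y := yoneda.obj b) (X := X) f' (𝟙 b) x'
          rw [h, ← e2] at e1
          simpa using e1
        rw [tensorSet_map_tmk, tensorSet_map_tmk]
        simpa using! e)
    induction t using Tensor.ind with
    | h c p z =>
      let g : c ⟶ a := (pullback.fst (yoneda.map f) (yoneda.map f')).app (op c) p
      let g' : c ⟶ a' := (pullback.snd (yoneda.map f) (yoneda.map f')).app (op c) p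
      refine ⟨c, g, g', z, ?_, ?_, ?_⟩
      · exact congrArg (fun k => k.app (op c) p)
          (pullback.condition (f := yoneda.map f) (g := yoneda.map f'))
      · rw [tensorSet_map_tmk] at h1
        exact (congrArg (yonedaEval X a) h1).trans (by rw [yonedaEval_tmk, X.map_id]; rfl)
      · rw [tensorSet_map_tmk] at h2
        exact (congrArg (yonedaEval X a') h2).trans (by rw [yonedaEval_tmk, X.map_id]; rfl)
  fork := by
    intro a b f f' x h
    have := hX WalkingParallelPair
    let hl := isLimitForkMapOfIsLimit (tensorSet.obj X) _
      (equalizerIsEqualizer (yoneda.map f) (yoneda.map f'))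
    obtain ⟨t, h1, -⟩ := Types.unique_of_type_equalizer _ _ hl (tmk (Y := yoneda.obj a) (𝟙 a) x) (by
        have e : (tmk (Y := yoneda.obj b) f x : Tensor (yoneda.obj b) X)
            = tmk (Y := yoneda.obj b) f' x := by
          have e1 := tmk_glue (Y := yoneda.obj b) (X := X) f (𝟙 b) x
          have e2 := tmk_glue (Y := yoneda.obj b) (X := X) f' (𝟙 b) x
          rw [h, ← e2] at e1
          simpa using e1
        rw [tensorSet_map_tmk, tensorSet_map_tmk]
        simpa using! e)
    induction t using Tensor.ind with
    | h c p z =>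
      let g : c ⟶ a := (equalizer.ι (yoneda.map f) (yoneda.map f')).app (op c) p
      refine ⟨c, g, z, ?_, ?_⟩
      · exact congrArg (fun k => k.app (op c) p)
          (equalizer.condition (yoneda.map f) (yoneda.map f'))
      · rw [tensorSet_map_tmk] at h1
        exact (congrArg (yonedaEval X a) h1).trans (by rw [yonedaEval_tmk, X.map_id]; rfl)

theorem IsComponentwiseFlat.exists_common_source {X : A ⥤ Type u} (hX : IsComponentwiseFlat X)
    {J : Type*} [Finite J] {b : J → A} (x : ∀ j, X.obj (b j)) (j₀ : J)
    (h : ∀ j, Linked X (x j₀) (x j)) :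
    ∃ (c : A) (z : X.obj c) (g : ∀ j, c ⟶ b j), ∀ j, X.map (g j) z = x j := by
  classical
  have := Fintype.ofFinite J
  have key : ∀ s : Finset J, ∃ (c : A) (z : X.obj c), Linked X (x j₀) z ∧
      ∀ j ∈ s, ∃ g : c ⟶ b j, X.map g z = x j := by
    intro s
    induction s using Finset.induction_on with
    | empty => exact ⟨_, x j₀, Linked.refl _, by simp⟩
    | insert j s _ ih =>
      obtain ⟨c, z, hz, hs⟩ := ih
      obtain ⟨d, k, k', w, rfl, e⟩ := hX.linked_trans hz.symm (h j)
      refine ⟨d, w, hX.linked_trans hz (Linked.of_map k w).symm, ?_⟩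
      intro i hi
      rcases Finset.mem_insert.1 hi with rfl | hi
      · exact ⟨k', e⟩
      · obtain ⟨g, hg⟩ := hs i hi
        exact ⟨k ≫ g, by simpa using hg⟩
  obtain ⟨c, z, -, hz⟩ := key Finset.univ
  choose g hg using fun j => hz j (Finset.mem_univ j)
  exact ⟨c, z, g, hg⟩

/-- Finitely many conditions on maps into `d`, each stable under precomposition and each achievable
by lifting elements further, can be achieved simultaneously. -/
theorem exists_refinement {X : A ⥤ Type u} {d : A} (z : X.obj d) {J : Type*} [Finite J]
    (P : J → ∀ {e : A}, (e ⟶ d) → Prop)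
    (hP : ∀ (j : J) {e e' : A} (k : e' ⟶ e) (h : e ⟶ d), P j h → P j (k ≫ h))
    (hP' : ∀ (j : J) {e : A} (h : e ⟶ d) (v : X.obj e), X.map h v = z →
      ∃ (e' : A) (k : e' ⟶ e) (v' : X.obj e'), X.map k v' = v ∧ P j (k ≫ h)) :
    ∃ (e : A) (h : e ⟶ d) (v : X.obj e), X.map h v = z ∧ ∀ j, P j h := by
  classical
  have := Fintype.ofFinite J
  have key : ∀ s : Finset J, ∃ (e : A) (h : e ⟶ d) (v : X.obj e),
      X.map h v = z ∧ ∀ j ∈ s, P j h := by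
    intro s
    induction s using Finset.induction_on with
    | empty => exact ⟨d, 𝟙 d, z, by simp, by simp⟩
    | insert j s _ ih =>
      obtain ⟨e, h, v, hv, hs⟩ := ih
      obtain ⟨e', k, v', rfl, hj⟩ := hP' j h v hv
      refine ⟨e', k ≫ h, v', by simpa using hv, fun i hi => ?_⟩
      rcases Finset.mem_insert.1 hi with rfl | hi
      · exact hj
      · exact hP _ _ _ (hs i hi)
  obtain ⟨e, h, v, hv, hs⟩ := key Finset.univ
  exact ⟨e, h, v, hv, fun j => hs j (Finset.mem_univ j)⟩

theorem IsComponentwiseFlat.exists_map_eq {X : A ⥤ Type u} (hX : IsComponentwiseFlat X)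
    {Y : Aᵒᵖ ⥤ Type u} {d : A} (y y' : Y.obj (op d)) (z : X.obj d)
    (h : (tmk y z : Tensor Y X) = tmk y' z) :
    ∃ (e : A) (k : e ⟶ d) (v : X.obj e), X.map k v = z ∧ Y.map k.op y = Y.map k.op y' := by
  obtain ⟨c, g, g', w, hw, hw', e⟩ := (hX.tmk_eq_iff _ _ _ _).1 h
  obtain ⟨p, q, v, hq, rfl⟩ := hX.fork g g' w (hw.trans hw'.symm)
  refine ⟨p, q ≫ g, v, by simpa using hw, ?_⟩
  conv_rhs => rw [hq]
  simp only [op_comp, Functor.map_comp, types_comp_apply, e]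

theorem IsComponentwiseFlat.exists_forall_map_eq {X : A ⥤ Type u} (hX : IsComponentwiseFlat X)
    {J : Type*} [Finite J] {Y : J → Aᵒᵖ ⥤ Type u} {d : A} (y y' : ∀ j, (Y j).obj (op d))
    (z : X.obj d) (h : ∀ j, (tmk (y j) z : Tensor (Y j) X) = tmk (y' j) z) :
    ∃ (e : A) (k : e ⟶ d) (v : X.obj e), X.map k v = z ∧
      ∀ j, (Y j).map k.op (y j) = (Y j).map k.op (y' j) := by
  refine exists_refinement z (fun j e k => (Y j).map k.op (y j) = (Y j).map k.op (y' j)) ?_ ?_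
  · intro j e e' k h hh
    simp only [op_comp, Functor.map_comp, types_comp_apply, hh]
  · intro j e k v hv
    obtain ⟨e', k', v', h1, h2⟩ := hX.exists_map_eq ((Y j).map k.op (y j)) ((Y j).map k.op (y' j)) v
      (by rw [tmk_glue, tmk_glue, hv, h j])
    exact ⟨e', k', v', h1, by simpa using h2⟩

/-- The finite connected limits in `Set` commute with the colimit `- ⊗ X`, because each component of
the category of elements of `X` is cofiltered. -/
theorem IsComponentwiseFlat.nondegenerateSet {X : A ⥤ Type u} (hX : IsComponentwiseFlat X) :
    NondegenerateSet X := by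
  intro J _ _ _
  refine ⟨fun {F} => ⟨fun {c} hc => (Types.isLimit_iff_bijective_sectionOfCone _).2 ⟨?_, ?_⟩⟩⟩
  · intro s s' h
    have hπ : ∀ j, Tensor.map (c.π.app j) (𝟙 X) s = Tensor.map (c.π.app j) (𝟙 X) s' := fun j =>
      congrFun (congrArg Subtype.val h) j
    induction s using Tensor.ind with
    | h b y x =>
    induction s' using Tensor.ind with
    | h b' y' x' =>
    obtain ⟨j₀⟩ : Nonempty J := inferInstance
    have hnat : ∀ (j : J) {b d : A} (g : d ⟶ b) (y : c.pt.obj (op b)),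
        (c.π.app j).app (op d) (c.pt.map g.op y)
          = (F.obj j).map g.op ((c.π.app j).app (op b) y) :=
      fun j _ _ g y => NatTrans.naturality_apply (c.π.app j) g.op y
    simp only [Tensor.map_tmk, NatTrans.id_app, types_id_apply] at hπ
    obtain ⟨d, g, g', z, rfl, rfl, -⟩ := (hX.tmk_eq_iff _ _ _ _).1 (hπ j₀)
    obtain ⟨e, k, v, rfl, hk⟩ := hX.exists_forall_map_eq
      (fun j => (c.π.app j).app (op d) (c.pt.map g.op y))
      (fun j => (c.π.app j).app (op d) (c.pt.map g'.op y')) z (fun j => by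
        rw [hnat, hnat, tmk_glue, tmk_glue, hπ j])
    have hev := isLimitOfPreserves ((evaluation _ _).obj (op e)) hc
    have : c.pt.map k.op (c.pt.map g.op y) = c.pt.map k.op (c.pt.map g'.op y') := by
      refine Concrete.isLimit_ext _ hev _ _ fun j => ?_
      have := hk j
      rw [← hnat, ← hnat] at this
      exact this
    rw [← tmk_glue g, ← tmk_glue g', ← tmk_glue k, ← tmk_glue k, this]
  · rintro ⟨t, ht⟩
    have rep : ∀ j, ∃ (b : A) (y : (F.obj j).obj (op b)) (x : X.obj b), t j = tmk y x := fun j =>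
      Tensor.ind (P := fun s => ∃ (b : A) (y : (F.obj j).obj (op b)) (x : X.obj b), s = tmk y x)
        (fun b y x => ⟨b, y, x, rfl⟩) (t j)
    choose b y x hyx using rep
    have ht' : ∀ {j k : J} (f : j ⟶ k),
        (tmk ((F.map f).app (op (b j)) (y j)) (x j) : Tensor (F.obj k) X) = tmk (y k) (x k) := by
      intro j k f
      have := ht f
      rw [hyx, hyx] at this
      exact this
    obtain ⟨j₀⟩ : Nonempty J := inferInstance
    have hlink : ∀ j, Linked X (x j₀) (x j) := by
      refine induct_on_objects {j | Linked X (x j₀) (x j)} (Linked.refl _) ?_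
      intro j k f
      obtain ⟨c, g, g', z, h1, h2, -⟩ := (hX.tmk_eq_iff _ _ _ _).1 (ht' f)
      have hjk : Linked X (x j) (x k) := ⟨c, g, g', z, h1, h2⟩
      exact ⟨fun h => hX.linked_trans h hjk, fun h => hX.linked_trans h hjk.symm⟩
    obtain ⟨d, z, g, hg⟩ := hX.exists_common_source x j₀ hlink
    have : Finite (Σ j : J, Σ k : J, (j ⟶ k)) := inferInstance
    obtain ⟨e, k, v, hv, hk⟩ := hX.exists_forall_map_eq
      (J := Σ j : J, Σ k : J, (j ⟶ k)) (Y := fun p => F.obj p.2.1)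
      (fun p => (F.map p.2.2).app (op d) ((F.obj p.1).map (g p.1).op (y p.1)))
      (fun p => (F.obj p.2.1).map (g p.2.1).op (y p.2.1)) z (by
        rintro ⟨i, j, f⟩
        dsimp only
        rw [NatTrans.naturality_apply, tmk_glue, tmk_glue, hg, hg, ht' f])
    have hev := isLimitOfPreserves ((evaluation _ _).obj (op e)) hc
    obtain ⟨w, hw⟩ := ((Types.isLimit_iff_bijective_sectionOfCone _).1 ⟨hev⟩).2
      ⟨fun j => (F.obj j).map k.op ((F.obj j).map (g j).op (y j)), by
        intro i j f
        have := hk ⟨i, j, f⟩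
        dsimp only at this
        rw [← NatTrans.naturality_apply] at this
        exact this⟩
    refine ⟨tmk w v, ?_⟩
    refine Subtype.ext (funext fun j => ?_)
    have hwj : (c.π.app j).app (op e) w = (F.obj j).map k.op ((F.obj j).map (g j).op (y j)) :=
      congrFun (congrArg Subtype.val hw) j
    change tmk ((c.π.app j).app (op e) w) v = t j
    rw [hwj, hyx j, ← hg j, ← hv, ← tmk_glue, ← tmk_glue]

end Elementary

/-! ### Infinite paths in finitely branching systems -/

section Paths

variable {L : ℕ → Type*}

/-- Dependent choice along a sequence of types. -/
theorem exists_seq_of_forall_exists (R : ∀ n, L n → L (n + 1) → Prop) (P : ∀ n, L n → Prop)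
    (h : ∀ n x, P n x → ∃ y, R n x y ∧ P (n + 1) y) (x₀ : L 0) (h₀ : P 0 x₀) :
    ∃ x : ∀ n, L n, x 0 = x₀ ∧ (∀ n, P n (x n)) ∧ ∀ n, R n (x n) (x (n + 1)) := by
  choose next hR hP using h
  let st : ∀ n, {x : L n // P n x} := fun n =>
    Nat.rec ⟨x₀, h₀⟩ (fun n s => ⟨next n s.1 s.2, hP n s.1 s.2⟩) n
  exact ⟨fun n => (st n).1, rfl, fun n => (st n).2, fun n => hR n (st n).1 (st n).2⟩

/-- `HasPath R k n x` means that a path of length `k` along the relations `R` starts at `x`. -/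
def HasPath (R : ∀ n, L n → L (n + 1) → Prop) : ℕ → ∀ n, L n → Prop
  | 0, _, _ => True
  | k + 1, n, x => ∃ y, R n x y ∧ HasPath R k (n + 1) y

theorem HasPath.of_succ {R : ∀ n, L n → L (n + 1) → Prop} :
    ∀ {k n : ℕ} {x : L n}, HasPath R (k + 1) n x → HasPath R k n x
  | 0, _, _, _ => trivial
  | _ + 1, _, _, ⟨y, hy, h⟩ => ⟨y, hy, HasPath.of_succ h⟩

theorem HasPath.anti {R : ∀ n, L n → L (n + 1) → Prop} {k l n : ℕ} {x : L n} (hkl : k ≤ l)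
    (h : HasPath R l n x) : HasPath R k n x := by
  induction l, hkl using Nat.le_induction with
  | base => exact h
  | succ l _ ih => exact ih h.of_succ

theorem exists_forall_of_antitone {α : Type*} [Finite α] {P : ℕ → α → Prop}
    (hP : ∀ {k l : ℕ} {x : α}, k ≤ l → P l x → P k x) (h : ∀ k, ∃ x, P k x) :
    ∃ x, ∀ k, P k x := by
  by_contra! hc
  choose K hK using hc
  obtain ⟨N, hN⟩ := Finite.exists_le K
  obtain ⟨x, hx⟩ := h N
  exact hK x (hP (hN x) hx)

/-- König's lemma for a sequence of relations between types that are finite from the first level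
on; the starting level may be infinite. -/
theorem exists_path_of_forall_hasPath [∀ n, Finite (L (n + 1))]
    (R : ∀ n, L n → L (n + 1) → Prop) (Q : L 0 → Prop)
    (h : ∀ k, ∃ x, Q x ∧ HasPath R k 0 x) :
    ∃ x : ∀ n, L n, Q (x 0) ∧ ∀ n, R n (x n) (x (n + 1)) := by
  obtain ⟨x₁, h₁⟩ : ∃ x₁, ∀ k, (∃ x₀, Q x₀ ∧ R 0 x₀ x₁) ∧ HasPath R k 1 x₁ := by
    refine exists_forall_of_antitone (fun hkl h => ⟨h.1, h.2.anti hkl⟩) fun k => ?_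
    obtain ⟨x₀, hQ, x₁, hR, hp⟩ := h (k + 1)
    exact ⟨x₁, ⟨x₀, hQ, hR⟩, hp⟩
  obtain ⟨x₀, hQ, hR⟩ := (h₁ 0).1
  obtain ⟨x, rfl, -, hx⟩ := exists_seq_of_forall_exists R (fun n x => ∀ k, HasPath R k n x)
    (fun n x hx => by
      obtain ⟨y, hy⟩ := exists_forall_of_antitone
        (P := fun k y => R n x y ∧ HasPath R k (n + 1) y)
        (fun hkl h => ⟨h.1, h.2.anti hkl⟩) (fun k => hx (k + 1))
      exact ⟨y, (hy 0).1, fun k => (hy k).2⟩)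
    x₀ (fun k => HasPath.of_succ ⟨x₁, hR, (h₁ k).2⟩)
  exact ⟨x, hQ, hx⟩

/-- If every element has a predecessor, then levels that are all inhabited contain arbitrarily long
paths. -/
theorem exists_hasPath_of_pred [∀ n, Nonempty (L n)] (R : ∀ n, L n → L (n + 1) → Prop)
    (hR : ∀ n y, ∃ x, R n x y) (k n : ℕ) : ∃ x, HasPath R k n x := by
  induction k generalizing n with
  | zero => exact ⟨Classical.arbitrary _, trivial⟩
  | succ k ih =>
    obtain ⟨y, hy⟩ := ih (n + 1)
    obtain ⟨x, hx⟩ := hR n y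
    exact ⟨x, y, hx, hy⟩

end Paths

/-! ### Complexes and their maps -/

section Complexes

variable {A : Type u} [SmallCategory A] {M : Profunctor.{u} A A}

namespace Sector

theorem push_id {b a : A} (m : Sector M b a) : m.push (𝟙 a) = m := by
  simp [push]

theorem pull_id {b a : A} (m : Sector M b a) : pull (𝟙 b) m = m := by
  simp [pull]

theorem push_comp {b a a' a'' : A} (m : Sector M b a) (f : a ⟶ a') (f' : a' ⟶ a'') :
    m.push (f ≫ f') = (m.push f).push f' := by
  simp [push]

theorem pull_comp {b b' b'' a : A} (g : b' ⟶ b) (g' : b'' ⟶ b') (m : Sector M b a) :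
    pull (g' ≫ g) m = pull g' (pull g m) := by
  simp [pull]

theorem pull_push {b b' a a' : A} (g : b' ⟶ b) (m : Sector M b a) (f : a ⟶ a') :
    pull g (m.push f) = (pull g m).push f :=
  (NatTrans.naturality_apply (M.map f) g.op m).symm

end Sector

namespace SectorComplex

/-- The complex without its first object and sector. -/
def shift (C : SectorComplex M) : SectorComplex M where
  obj n := C.obj (n + 1)
  sector n := C.sector (n + 1)

/-- The complex without its first `k` objects and sectors. -/
def drop (k : ℕ) (C : SectorComplex M) : SectorComplex M where
  obj n := C.obj (k + n)
  sector n := C.sector (k + n)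

/-- The complex with a sector `m : C₀ ⇸ a` adjoined at the beginning. -/
def cons (C : SectorComplex M) {a : A} (m : Sector M (C.obj 0) a) : SectorComplex M where
  obj
    | 0 => a
    | n + 1 => C.obj n
  sector
    | 0 => m
    | n + 1 => C.sector n

/-- The complex obtained by iterating a step on a type of states, each state lying over an object
and each step over a sector. -/
def ofStep {S : Type*} (ob : S → A) (step : S → S) (sec : ∀ s, Sector M (ob (step s)) (ob s))
    (s : S) : SectorComplex M where
  obj n := ob (step^[n] s)
  sector n := Nat.rec (motive := fun n => ∀ s, Sector M (ob (step^[n + 1] s)) (ob (step^[n] s)))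
    sec (fun _ ih s => ih (step s)) n s

namespace Map

variable {B C D : SectorComplex M}

/-- The identity map of a complex. -/
def id (C : SectorComplex M) : C.Map C where
  app n := 𝟙 _
  comm n := by rw [Sector.push_id, Sector.pull_id]

/-- The composite of two maps of complexes. -/
def comp (f : B.Map C) (g : C.Map D) : B.Map D where
  app n := f.app n ≫ g.app n
  comm n := by
    rw [Sector.push_comp, f.comm, ← Sector.pull_push, g.comm, ← Sector.pull_comp]

/-- The map of complexes obtained by forgetting the component in degree `0`. -/
def shift (f : C.Map D) : C.shift.Map D.shift where
  app n := f.app (n + 1)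
  comm n := f.comm (n + 1)

/-- The map of complexes obtained by forgetting the components in degrees below `k`. -/
def drop (k : ℕ) (f : C.Map D) : (C.drop k).Map (D.drop k) where
  app n := f.app (k + n)
  comm n := f.comm (k + n)

/-- A map of complexes extends to complexes with one more sector at the beginning. -/
def cons (f : C.Map D) {a a' : A} {m : Sector M (C.obj 0) a} {p : Sector M (D.obj 0) a'}
    (g : a ⟶ a') (h : m.push g = Sector.pull (f.app 0) p) : (C.cons m).Map (D.cons p) where
  app
    | 0 => g
    | n + 1 => f.app n
  comm
    | 0 => h
    | n + 1 => f.comm n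

/-- Adjoining the sector that was removed by `shift` gives back a complex. -/
def consShift (C : SectorComplex M) {a : A} (h : C.obj 0 ⟶ a) :
    C.Map (C.shift.cons ((C.sector 0).push h)) where
  app
    | 0 => h
    | n + 1 => 𝟙 (C.obj (n + 1))
  comm
    | 0 => (Sector.pull_id _).symm
    | n + 1 => (Sector.push_id (C.sector (n + 1))).trans (Sector.pull_id (C.sector (n + 1))).symm

end Map

/-- Spans between the objects in degree `n` of two complexes. -/
structure SpanAt (C D : SectorComplex M) (n : ℕ) where
  /-- The apex of the span. -/
  apex : A
  /-- The leg to the first complex. -/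
  left : apex ⟶ C.obj n
  /-- The leg to the second complex. -/
  right : apex ⟶ D.obj n

/-- Spans in consecutive degrees are compatible when some sector between their apexes is compatible
with the sectors of both complexes. -/
def SpanStep {C D : SectorComplex M} (n : ℕ) (s : SpanAt C D n) (t : SpanAt C D (n + 1)) : Prop :=
  ∃ m : Sector M t.apex s.apex,
    m.push s.left = Sector.pull t.left (C.sector n) ∧
    m.push s.right = Sector.pull t.right (D.sector n)

theorem exists_span_of_steps {C D : SectorComplex M} (s : ∀ n, SpanAt C D n)
    (hs : ∀ n, SpanStep n (s n) (s (n + 1))) :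
    ∃ (E : SectorComplex M) (u : E.Map C) (v : E.Map D),
      ∀ n, (⟨E.obj n, u.app n, v.app n⟩ : SpanAt C D n) = s n := by
  choose m hm hm' using hs
  exact ⟨⟨fun n => (s n).apex, m⟩, ⟨fun n => (s n).left, hm⟩, ⟨fun n => (s n).right, hm'⟩,
    fun n => rfl⟩

/-- Any object `b` which is the source of a sector `m` receives only finitely many maps, since a map
`g : c ⟶ b` is a morphism of the finite category of elements between `(c, m g)` and `(b, m)`. -/
theorem finite_maps_into (hM : IsEquationalSystem M) {b a : A} (m : Sector M b a) :
    Finite (Σ c : A, (c ⟶ b)) := by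
  obtain ⟨h1, h2⟩ := hM.finite a
  let p : (M.obj a).Elements := ⟨op b, m⟩
  have := h2 p
  refine Finite.of_injective (β := Σ q : (M.obj a).Elements, (p ⟶ q))
    (fun x => ⟨⟨op x.1, Sector.pull x.2 m⟩, ⟨x.2.op, rfl⟩⟩) ?_
  rintro ⟨c, g⟩ ⟨c', g'⟩ h
  have hc : op c = op c' := congrArg (fun x => x.1.1) h
  obtain rfl : c = c' := op_injective hc
  have h3 : (Sector.pull g m : Sector M c a) = Sector.pull g' m := by
    have := congrArg Sigma.fst h
    exact eq_of_heq (Sigma.mk.inj this).2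
  have key : ∀ (q q' : (M.obj a).Elements) (k : p ⟶ q) (k' : p ⟶ q'),
      (⟨q, k⟩ : Σ q : (M.obj a).Elements, (p ⟶ q)) = ⟨q', k'⟩ → HEq k.1 k'.1 := by
    rintro q q' k k' h
    cases h
    rfl
  have := key _ _ _ _ h
  exact congrArg (Sigma.mk c) (Quiver.Hom.op_inj (eq_of_heq this))

theorem finite_spanAt (hM : IsEquationalSystem M) (C D : SectorComplex M) (n : ℕ) :
    Finite (SpanAt C D (n + 1)) := by
  have := finite_maps_into hM (C.sector n)
  have := finite_maps_into hM (D.sector n)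
  refine Finite.of_injective
    (β := (Σ c : A, (c ⟶ C.obj (n + 1))) × (Σ c : A, (c ⟶ D.obj (n + 1))))
    (fun s => (⟨s.apex, s.left⟩, ⟨s.apex, s.right⟩)) ?_
  rintro ⟨c, l, r⟩ ⟨c', l', r'⟩ h
  obtain ⟨h1, h2⟩ := Prod.mk.inj h
  cases h1
  cases h2
  rfl

/-- Condition S1 completes cospans of complexes to commutative squares of complexes: squares exist
in each degree, nondegeneracy of `M` extends them downwards, and finiteness of `M` then yields
a compatible choice in all degrees. -/
theorem exists_square (hM : IsEquationalSystem M) (hS : SolvableS1 M) {B C D : SectorComplex M}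
    (f : C.Map B) (f' : D.Map B) :
    ∃ (E : SectorComplex M) (u : E.Map C) (v : E.Map D),
      ∀ n, u.app n ≫ f.app n = v.app n ≫ f'.app n := by
  let L : ℕ → Type u := fun n =>
    {s : SpanAt C D n // s.left ≫ f.app n = s.right ≫ f'.app n}
  let R : ∀ n, L n → L (n + 1) → Prop := fun n s t => SpanStep n s.1 t.1
  have : ∀ n, Nonempty (L n) := fun n => by
    obtain ⟨c, g, g', h⟩ := hS _ _ _ (f.drop n) (f'.drop n)
    exact ⟨⟨⟨c, g, g'⟩, h⟩⟩
  have : ∀ n, Finite (L (n + 1)) := fun n => by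
    have := finite_spanAt hM C D n
    infer_instance
  have hR : ∀ n y, ∃ x, R n x y := by
    rintro n ⟨⟨c, l, r⟩, h⟩
    -- The sectors induced along the legs agree over `Bₙ`, so nondegeneracy of `M(c, -)` applies.
    obtain ⟨d, g, g', z, e, h1, h2⟩ := (hM.nondegenerate c).isComponentwiseFlat.square
      (f.app n) (f'.app n) (Sector.pull l (C.sector n)) (Sector.pull r (D.sector n)) (by
        change (Sector.pull l (C.sector n)).push (f.app n)
          = (Sector.pull r (D.sector n)).push (f'.app n)
        rw [← Sector.pull_push, ← Sector.pull_push, f.comm, f'.comm, ← Sector.pull_comp,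
          ← Sector.pull_comp]
        exact congrArg (fun k => Sector.pull k (B.sector n)) h)
    exact ⟨⟨⟨d, g, g'⟩, e⟩, z, h1, h2⟩
  obtain ⟨x, -, hx⟩ := exists_path_of_forall_hasPath R (fun _ => True)
    (fun k => (exists_hasPath_of_pred R hR k 0).imp fun _ h => ⟨trivial, h⟩)
  obtain ⟨E, u, v, h⟩ := exists_span_of_steps (fun n => (x n).1) hx
  refine ⟨E, u, v, fun n => ?_⟩
  have := (x n).2
  rw [← h n] at this
  exact this

/-- Condition S2 extends parallel pairs of maps of complexes to forks of complexes, by the argument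
of `exists_square`, with spans having equal legs in place of single maps. -/
theorem exists_fork (hM : IsEquationalSystem M) (hS : SolvableS2 M) {B C : SectorComplex M}
    (f f' : C.Map B) :
    ∃ (E : SectorComplex M) (u : E.Map C), ∀ n, u.app n ≫ f.app n = u.app n ≫ f'.app n := by
  let L : ℕ → Type u := fun n =>
    {s : SpanAt C C n // s.left = s.right ∧ s.left ≫ f.app n = s.left ≫ f'.app n}
  let R : ∀ n, L n → L (n + 1) → Prop := fun n s t => SpanStep n s.1 t.1
  have : ∀ n, Nonempty (L n) := fun n => by
    obtain ⟨c, g, h⟩ := hS _ _ (f.drop n) (f'.drop n)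
    exact ⟨⟨⟨c, g, g⟩, rfl, h⟩⟩
  have : ∀ n, Finite (L (n + 1)) := fun n => by
    have := finite_spanAt hM C C n
    infer_instance
  have hR : ∀ n y, ∃ x, R n x y := by
    rintro n ⟨⟨c, l, r⟩, hlr, h⟩
    obtain rfl : l = r := hlr
    obtain ⟨d, g, z, e, h1⟩ := (hM.nondegenerate c).isComponentwiseFlat.fork
      (f.app n) (f'.app n) (Sector.pull l (C.sector n)) (by
        change (Sector.pull l (C.sector n)).push (f.app n)
          = (Sector.pull l (C.sector n)).push (f'.app n)
        rw [← Sector.pull_push, ← Sector.pull_push, f.comm, f'.comm, ← Sector.pull_comp,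
          ← Sector.pull_comp]
        exact congrArg (fun k => Sector.pull k (B.sector n)) h)
    exact ⟨⟨⟨d, g, g⟩, rfl, e⟩, z, h1, h1⟩
  obtain ⟨x, -, hx⟩ := exists_path_of_forall_hasPath R (fun _ => True)
    (fun k => (exists_hasPath_of_pred R hR k 0).imp fun _ h => ⟨trivial, h⟩)
  obtain ⟨E, u, v, h⟩ := exists_span_of_steps (fun n => (x n).1) hx
  refine ⟨E, u, fun n => ?_⟩
  have := (x n).2.2
  rw [← h n] at this
  exact this

end SectorComplex

end Complexes

/-! ### The universal solution as a functor to sets -/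

section Solution

variable {A : Type u} [SmallCategory A]

/-- The functor `I` with `I(a)` the colimit of the sets `A(C₀, a)` over all complexes `C`: its
elements are represented by a complex `C` with a map `h : C₀ ⟶ a`, and two such pairs are identified
when some span of complexes makes the resulting square over `a` commute. (Condition S makes this
relation transitive.) -/
def solution (M : Profunctor.{u} A A) : A ⥤ Type u where
  obj a := Quot (fun p q : Σ C : SectorComplex M, (C.obj 0 ⟶ a) =>
    ∃ (E : SectorComplex M) (u : E.Map p.1) (v : E.Map q.1), u.app 0 ≫ p.2 = v.app 0 ≫ q.2)
  map f := TypeCat.ofHom (Quot.map (fun p => ⟨p.1, p.2 ≫ f⟩) (by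
    rintro ⟨C, h⟩ ⟨D, k⟩ ⟨E, u, v, e⟩
    exact ⟨E, u, v, by simpa using congrArg (· ≫ f) e⟩))
  map_id a := by
    ext x
    induction x using Quot.ind
    simp [Quot.map]
  map_comp f g := by
    ext x
    induction x using Quot.ind
    simp [Quot.map]

variable {M : Profunctor.{u} A A}

/-- The element of the universal solution represented by a complex `C` and a map `C₀ ⟶ a`. -/
def point {a : A} (C : SectorComplex M) (h : C.obj 0 ⟶ a) : (solution M).obj a :=
  Quot.mk _ ⟨C, h⟩

theorem point_ind {a : A} {P : (solution M).obj a → Prop}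
    (h : ∀ (C : SectorComplex M) (h : C.obj 0 ⟶ a), P (point C h)) (x : (solution M).obj a) : P x :=
  Quot.ind (fun p => h p.1 p.2) x

theorem solution_map_point {a a' : A} (C : SectorComplex M) (h : C.obj 0 ⟶ a) (f : a ⟶ a') :
    (solution M).map f (point C h) = point C (h ≫ f) := rfl

theorem point_eq_of_span {a : A} {C D E : SectorComplex M} {h : C.obj 0 ⟶ a} {k : D.obj 0 ⟶ a}
    (u : E.Map C) (v : E.Map D) (e : u.app 0 ≫ h = v.app 0 ≫ k) : point C h = point D k :=
  Quot.sound ⟨E, u, v, e⟩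

theorem point_map {a : A} {C E : SectorComplex M} (u : E.Map C) (h : C.obj 0 ⟶ a) :
    point E (u.app 0 ≫ h) = point C h :=
  point_eq_of_span (SectorComplex.Map.id E) u (by simp [SectorComplex.Map.id])

/-- Under condition S1, representatives of one element are connected by a single span. -/
theorem exists_span_of_point_eq (hM : IsEquationalSystem M) (hS : SolvableS1 M) {a : A}
    {C D : SectorComplex M} {h : C.obj 0 ⟶ a} {k : D.obj 0 ⟶ a} (e : point C h = point D k) :
    ∃ (E : SectorComplex M) (u : E.Map C) (v : E.Map D), u.app 0 ≫ h = v.app 0 ≫ k := by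
  have key := Quot.eqvGen_exact e
  have gen : ∀ p q : Σ C : SectorComplex M, (C.obj 0 ⟶ a), Relation.EqvGen
      (fun p q : Σ C : SectorComplex M, (C.obj 0 ⟶ a) => ∃ (E : SectorComplex M) (u : E.Map p.1)
        (v : E.Map q.1), u.app 0 ≫ p.2 = v.app 0 ≫ q.2) p q →
      ∃ (E : SectorComplex M) (u : E.Map p.1) (v : E.Map q.1),
        u.app 0 ≫ p.2 = v.app 0 ≫ q.2 := by
    intro p q hpq
    induction hpq with
    | rel p q h => exact h
    | refl p => exact ⟨p.1, SectorComplex.Map.id _, SectorComplex.Map.id _, rfl⟩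
    | symm p q _ ih =>
      obtain ⟨E, u, v, e⟩ := ih
      exact ⟨E, v, u, e.symm⟩
    | trans p q r _ _ ih ih' =>
      obtain ⟨E, u, v, e⟩ := ih
      obtain ⟨E', u', v', e'⟩ := ih'
      obtain ⟨F, w, w', ew⟩ := SectorComplex.exists_square hM hS v u'
      refine ⟨F, w.comp u, w'.comp v', ?_⟩
      simp only [SectorComplex.Map.comp, Category.assoc]
      rw [e, ← e', ← Category.assoc, ← Category.assoc, ew 0]
  exact gen _ _ key

theorem isComponentwiseFlat_solution (hM : IsEquationalSystem M) (hS : Solvable M) :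
    IsComponentwiseFlat (solution M) where
  square := by
    intro a a' b f f' x x' e
    induction x using point_ind with
    | h C h =>
    induction x' using point_ind with
    | h D k =>
    obtain ⟨E, u, v, e⟩ := exists_span_of_point_eq hM hS.1 e
    refine ⟨E.obj 0, u.app 0 ≫ h, v.app 0 ≫ k, point E (𝟙 _), by simpa using e, ?_, ?_⟩
    · rw [solution_map_point, Category.id_comp, point_map]
    · rw [solution_map_point, Category.id_comp, point_map]
  fork := by
    intro a b f f' x e
    induction x using point_ind with
    | h C h =>
    obtain ⟨E, u, v, e⟩ := exists_span_of_point_eq hM hS.1 e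
    obtain ⟨F, w, hw⟩ := SectorComplex.exists_fork hM hS.2 u v
    refine ⟨F.obj 0, w.app 0 ≫ u.app 0 ≫ h, point F (𝟙 _), ?_, ?_⟩
    · simp only [Category.assoc]
      rw [e, reassoc_of% hw 0]
    · rw [solution_map_point, Category.id_comp]
      simpa [SectorComplex.Map.comp] using point_map (w.comp u) h

/-- The action of a sector `m : b ⇸ a` as a map `I(b) → I(a)`, prefixing `m` to complexes. -/
def prefixMap {b a : A} (m : Sector M b a) : (solution M).obj b → (solution M).obj a :=
  Quot.lift (fun p => point (p.1.cons (Sector.pull p.2 m)) (𝟙 a)) (by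
    rintro ⟨C, h⟩ ⟨D, k⟩ ⟨E, u, v, e⟩
    dsimp only at e ⊢
    refine point_eq_of_span (E := E.cons (Sector.pull (u.app 0 ≫ h) m))
      (u.cons (𝟙 a) ?_) (v.cons (𝟙 a) ?_) rfl
    · rw [Sector.push_id, Sector.pull_comp]
    · rw [Sector.push_id, e, Sector.pull_comp])

theorem prefixMap_point {b a : A} (m : Sector M b a) (C : SectorComplex M) (h : C.obj 0 ⟶ b) :
    prefixMap m (point C h) = point (C.cons (Sector.pull h m)) (𝟙 a) := rfl

theorem prefixMap_pull {b b' a : A} (g : b' ⟶ b) (m : Sector M b a) (x : (solution M).obj b') :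
    prefixMap (Sector.pull g m) x = prefixMap m ((solution M).map g x) := by
  induction x using point_ind with
  | h C h => rw [solution_map_point, prefixMap_point, prefixMap_point, Sector.pull_comp]

/-- The structure map of a coalgebra on elements. -/
def unfoldElem {X : A ⥤ Type u} (ξ : X ⟶ (modTensorSet M).obj X) {a : A} (x : X.obj a) :
    Tensor (M.obj a) X := ξ.app a x

theorem unfoldElem_map {X : A ⥤ Type u} (ξ : X ⟶ (modTensorSet M).obj X) {a a' b : A}
    (f : a ⟶ a') {x : X.obj a} {m : Sector M b a} {y : X.obj b} (h : unfoldElem ξ x = tmk m y) :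
    unfoldElem ξ (X.map f x) = tmk (m.push f) y := by
  have e : unfoldElem ξ (X.map f x) = Tensor.map (M.map f) (𝟙 X) (unfoldElem ξ x) :=
    NatTrans.naturality_apply ξ f x
  rw [e, h]
  rfl

theorem unfoldElem_hom {X X' : A ⥤ Type u} {ξ : X ⟶ (modTensorSet M).obj X}
    {ξ' : X' ⟶ (modTensorSet M).obj X'} {α : X ⟶ X'}
    (hα : ξ ≫ (modTensorSet M).map α = α ≫ ξ') {a b : A}
    {x : X.obj a} {m : Sector M b a} {y : X.obj b} (h : unfoldElem ξ x = tmk m y) :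
    unfoldElem ξ' (α.app a x) = tmk m (α.app b y) := by
  have e : Tensor.map (𝟙 (M.obj a)) α (unfoldElem ξ x) = unfoldElem ξ' (α.app a x) :=
    congrArg (fun k => k.app a x) hα
  rw [← e, h]
  rfl

theorem exists_unfoldElem_eq {X : A ⥤ Type u} (ξ : X ⟶ (modTensorSet M).obj X) {a : A}
    (x : X.obj a) : ∃ (b : A) (m : Sector M b a) (y : X.obj b), unfoldElem ξ x = tmk m y :=
  Tensor.ind (P := fun s => ∃ (b : A) (m : Sector M b a) (y : X.obj b), s = tmk m y)
    (fun b m y => ⟨b, m, y, rfl⟩) (unfoldElem ξ x)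

/-- The coalgebra structure `I ⟶ M ⊗ I`, splitting off the first sector of a complex. -/
def solutionStr (M : Profunctor.{u} A A) : solution M ⟶ (modTensorSet M).obj (solution M) where
  app a := TypeCat.ofHom (Quot.lift
    (fun p => (tmk ((p.1.sector 0).push p.2) (point p.1.shift (𝟙 _)) :
      Tensor (M.obj a) (solution M))) (by
    have key : ∀ {C E : SectorComplex M} (u : E.Map C) (h : C.obj 0 ⟶ a),
        (tmk ((E.sector 0).push (u.app 0 ≫ h)) (point E.shift (𝟙 _)) :
          Tensor (M.obj a) (solution M)) = tmk ((C.sector 0).push h) (point C.shift (𝟙 _)) := by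
      intro C E u h
      rw [Sector.push_comp, u.comm, ← Sector.pull_push]
      refine (tmk_glue _ _ _).trans (congrArg (tmk _) ?_)
      exact (congrArg (point E.shift) ((Category.id_comp (u.app 1)).trans
        (Category.comp_id (u.app 1)).symm)).trans (point_map u.shift (𝟙 _))
    rintro ⟨C, h⟩ ⟨D, k⟩ ⟨E, u, v, e⟩
    dsimp only at e ⊢
    rw [← key u h, e, key v k]))
  naturality a a' f := by
    ext x
    induction x using point_ind with
    | h C h =>
      change (tmk ((C.sector 0).push (h ≫ f)) (point C.shift (𝟙 _)) :
        Tensor (M.obj a') (solution M)) = tmk (((C.sector 0).push h).push f) _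
      rw [Sector.push_comp]
      rfl

theorem unfoldElem_point {a : A} (C : SectorComplex M) (h : C.obj 0 ⟶ a) :
    unfoldElem (solutionStr M) (point C h) = tmk ((C.sector 0).push h) (point C.shift (𝟙 _)) := rfl

theorem unfoldElem_prefixMap {b a : A} (m : Sector M b a) (x : (solution M).obj b) :
    unfoldElem (solutionStr M) (prefixMap m x) = tmk m x := by
  induction x using point_ind with
  | h C h =>
    have e : unfoldElem (solutionStr M) (prefixMap m (point C h))
        = tmk ((Sector.pull h m).push (𝟙 a)) (point C (𝟙 _)) := rfl
    rw [e, Sector.push_id]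
    refine (tmk_glue h m (point C (𝟙 _))).trans ?_
    rw [solution_map_point, Category.id_comp]

/-- The inverse `M ⊗ I ⟶ I` of the structure map. -/
def foldElem {a : A} : Tensor (M.obj a) (solution M) → (solution M).obj a :=
  Quot.lift (fun s => prefixMap (M := M) (a := a) s.1.2 s.2) (by
    rintro _ _ ⟨g, m, x⟩
    exact prefixMap_pull g m x)

theorem foldElem_unfoldElem {a : A} (x : (solution M).obj a) :
    foldElem (unfoldElem (solutionStr M) x) = x := by
  induction x using point_ind with
  | h C h =>
    have key : ∀ p, p = (C.sector 0).push h → point (C.shift.cons p) (𝟙 a) = point C h := by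
      rintro _ rfl
      refine point_eq_of_span (SectorComplex.Map.consShift C h) (SectorComplex.Map.id C) ?_
      exact (Category.comp_id h).trans (Category.id_comp h).symm
    exact key _ (Sector.pull_id _)

theorem eq_prefixMap_of_unfoldElem_eq {b a : A} {m : Sector M b a} {x : (solution M).obj a}
    {y : (solution M).obj b} (h : unfoldElem (solutionStr M) x = tmk m y) : x = prefixMap m y := by
  rw [← foldElem_unfoldElem x, h]
  rfl

/-! ### Resolutions of elements of coalgebras -/

/-- A resolution of `x₀` in a coalgebra is a complex `C` with elements `xₙ ∈ X(Cₙ)` such that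
`ξ(xₙ) = mₙ₊₁ ⊗ xₙ₊₁`. -/
def IsResolution {X : A ⥤ Type u} (ξ : X ⟶ (modTensorSet M).obj X) (C : SectorComplex M)
    (x : ∀ n, X.obj (C.obj n)) : Prop :=
  ∀ n, unfoldElem ξ (x n) = tmk (C.sector n) (x (n + 1))

theorem exists_resolution {X : A ⥤ Type u} (ξ : X ⟶ (modTensorSet M).obj X) {a : A} (x : X.obj a) :
    ∃ (C : SectorComplex M) (h : C.obj 0 ⟶ a) (y : ∀ n, X.obj (C.obj n)),
      IsResolution ξ C y ∧ X.map h (y 0) = x := by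
  obtain ⟨f, h0, -, hf⟩ := exists_seq_of_forall_exists (L := fun _ => Σ a : A, X.obj a)
    (fun _ s t => ∃ m : Sector M t.1 s.1, unfoldElem ξ s.2 = tmk m t.2) (fun _ _ => True)
    (fun _ s _ => by
      obtain ⟨b, m, y, h⟩ := exists_unfoldElem_eq ξ s.2
      exact ⟨⟨b, y⟩, ⟨m, h⟩, trivial⟩) ⟨a, x⟩ trivial
  choose m hm using hf
  have : ∃ h : (f 0).1 ⟶ a, X.map h (f 0).2 = x := by
    rw [h0]
    exact ⟨𝟙 a, by simp⟩
  obtain ⟨h, hh⟩ := this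
  exact ⟨⟨fun n => (f n).1, m⟩, h, fun n => (f n).2, hm, hh⟩

/-- Any two resolutions of an element are connected by a span of resolutions. -/
theorem point_eq_of_resolutions {X : A ⥤ Type u} (hX : IsComponentwiseFlat X)
    {ξ : X ⟶ (modTensorSet M).obj X} {C D : SectorComplex M} {y : ∀ n, X.obj (C.obj n)}
    {w : ∀ n, X.obj (D.obj n)} (hy : IsResolution ξ C y) (hw : IsResolution ξ D w) {a : A}
    {h : C.obj 0 ⟶ a} {k : D.obj 0 ⟶ a} (e : X.map h (y 0) = X.map k (w 0)) :
    point C h = point D k := by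
  obtain ⟨c, l, r, z, hlr, hl, hr⟩ := hX.square h k _ _ e
  obtain ⟨s, h0, -, hs⟩ := exists_seq_of_forall_exists
    (L := fun n => Σ s : SectorComplex.SpanAt C D n, X.obj s.apex)
    (fun n s t => SectorComplex.SpanStep n s.1 t.1)
    (fun n s => X.map s.1.left s.2 = y n ∧ X.map s.1.right s.2 = w n) (by
      rintro n ⟨⟨c, l, r⟩, z⟩ ⟨hl, hr⟩
      dsimp only at l r z hl hr
      -- Write `ξ(z) = p ⊗ q`, then lift `q` twice so that the decompositions of `ξ(yₙ)` and of
      -- `ξ(wₙ)` induced along the two legs become images of the given ones.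
      obtain ⟨b, p, q, hp⟩ := exists_unfoldElem_eq ξ z
      have el := unfoldElem_map ξ l hp
      rw [hl, hy n] at el
      obtain ⟨b', l', g, q', hl', rfl, e1⟩ := (hX.tmk_eq_iff _ _ _ _).1 el
      have er := unfoldElem_map ξ r hp
      rw [hr, hw n, ← tmk_glue g] at er
      obtain ⟨b'', r', g', q'', hr', rfl, e2⟩ := (hX.tmk_eq_iff _ _ _ _).1 er
      refine ⟨⟨⟨b'', g' ≫ l', r'⟩, q''⟩, ⟨Sector.pull (g' ≫ g) p, ?_, ?_⟩, ?_, ?_⟩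
      · rw [← Sector.pull_push, Sector.pull_comp, Sector.pull_comp]
        exact congrArg (Sector.pull g') e1.symm
      · rw [← Sector.pull_push, Sector.pull_comp]
        exact e2.symm
      · simpa using hl'
      · exact hr')
    ⟨⟨c, l, r⟩, z⟩ ⟨hl, hr⟩
  obtain ⟨E, u, v, huv⟩ := SectorComplex.exists_span_of_steps (fun n => (s n).1) hs
  refine point_eq_of_span u v ?_
  have h1 : (⟨E.obj 0, u.app 0, v.app 0⟩ : SectorComplex.SpanAt C D 0) = ⟨c, l, r⟩ := by
    rw [huv 0, h0]
  have h2 : ∀ t : SectorComplex.SpanAt C D 0, t = ⟨c, l, r⟩ → t.left ≫ h = t.right ≫ k := by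
    rintro t rfl
    exact hlr
  exact h2 _ h1

/-- The map from a coalgebra to the universal solution sending an element to the class of its
resolutions. -/
noncomputable def classify {X : A ⥤ Type u} (ξ : X ⟶ (modTensorSet M).obj X) {a : A}
    (x : X.obj a) : (solution M).obj a :=
  point (exists_resolution ξ x).choose (exists_resolution ξ x).choose_spec.choose

theorem classify_eq {X : A ⥤ Type u} (hX : IsComponentwiseFlat X)
    {ξ : X ⟶ (modTensorSet M).obj X} {C : SectorComplex M} {y : ∀ n, X.obj (C.obj n)}
    (hy : IsResolution ξ C y) {a : A} (h : C.obj 0 ⟶ a) :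
    classify ξ (X.map h (y 0)) = point C h := by
  obtain ⟨w, hw, e⟩ := (exists_resolution ξ (X.map h (y 0))).choose_spec.choose_spec
  exact point_eq_of_resolutions hX hw hy e

/-- `classify` as a natural transformation. -/
noncomputable def classifyHom {X : A ⥤ Type u} (hX : IsComponentwiseFlat X)
    (ξ : X ⟶ (modTensorSet M).obj X) : X ⟶ solution M where
  app a := TypeCat.ofHom (classify ξ)
  naturality a a' f := by
    ext x
    obtain ⟨C, h, y, hy, rfl⟩ := exists_resolution ξ x
    change classify ξ (X.map f (X.map h (y 0))) = (solution M).map f (classify ξ (X.map h (y 0)))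
    rw [classify_eq hX hy, ← X.map_comp_apply, classify_eq hX hy, solution_map_point]

theorem IsResolution.tail {X : A ⥤ Type u} {ξ : X ⟶ (modTensorSet M).obj X} {C : SectorComplex M}
    {x : ∀ n, X.obj (C.obj n)} (h : IsResolution ξ C x) :
    IsResolution ξ C.shift (fun n => x (n + 1)) :=
  fun n => h (n + 1)

theorem classifyHom_comm {X : A ⥤ Type u} (hX : IsComponentwiseFlat X)
    (ξ : X ⟶ (modTensorSet M).obj X) :
    ξ ≫ (modTensorSet M).map (classifyHom hX ξ) = classifyHom hX ξ ≫ solutionStr M := by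
  ext a x
  obtain ⟨C, h, y, hy, rfl⟩ := exists_resolution ξ x
  have e1 := unfoldElem_map ξ h (hy 0)
  change Tensor.map (𝟙 (M.obj a)) (classifyHom hX ξ) (unfoldElem ξ (X.map h (y 0)))
    = unfoldElem (solutionStr M) (classify ξ (X.map h (y 0)))
  rw [e1, classify_eq hX hy, unfoldElem_point]
  change tmk _ (classify ξ (y 1)) = _
  have e2 := classify_eq hX hy.tail (𝟙 _)
  rw [X.map_id] at e2
  exact congrArg (tmk _) e2

end Solution

/-! ### Separation of points by truncated complexes -/

section Cylinders

variable {A : Type u} [SmallCategory A] {M : Profunctor.{u} A A}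

/-- A map in degree `n` extends one degree further when a map in degree `n + 1` is compatible with
it. -/
def MapStep {D C : SectorComplex M} (n : ℕ) (f : D.obj n ⟶ C.obj n)
    (g : D.obj (n + 1) ⟶ C.obj (n + 1)) : Prop :=
  (D.sector n).push f = Sector.pull g (C.sector n)

/-- `IsNear k C h x` means that `x` is represented by a complex that maps to `C`, over the map `h`,
in degrees up to `k`. -/
def IsNear (k : ℕ) {a : A} (C : SectorComplex M) (h : C.obj 0 ⟶ a) (x : (solution M).obj a) :
    Prop :=
  ∃ (D : SectorComplex M) (f : D.obj 0 ⟶ C.obj 0),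
    point D (f ≫ h) = x ∧ HasPath (MapStep (D := D) (C := C)) k 0 f

theorem hasPath_mapStep_of_map {D C : SectorComplex M} (f : D.Map C) (k n : ℕ) :
    HasPath (MapStep (D := D) (C := C)) k n (f.app n) := by
  induction k generalizing n with
  | zero => trivial
  | succ k ih => exact ⟨f.app (n + 1), f.comm n, ih (n + 1)⟩

theorem isNear_point (k : ℕ) {a : A} (C : SectorComplex M) (h : C.obj 0 ⟶ a) :
    IsNear k C h (point C h) :=
  ⟨C, 𝟙 _, by rw [Category.id_comp], hasPath_mapStep_of_map (SectorComplex.Map.id C) k 0⟩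

theorem hasPath_spanStep {C D C' D' E : SectorComplex M} (u : E.Map C') (v : E.Map D') {k n : ℕ}
    {f : C'.obj n ⟶ C.obj n} {g : D'.obj n ⟶ D.obj n}
    (hf : HasPath (MapStep (D := C') (C := C)) k n f)
    (hg : HasPath (MapStep (D := D') (C := D)) k n g) :
    HasPath (SectorComplex.SpanStep (C := C) (D := D)) k n
      ⟨E.obj n, u.app n ≫ f, v.app n ≫ g⟩ := by
  induction k generalizing n with
  | zero => trivial
  | succ k ih =>
    obtain ⟨f', hf', hf⟩ := hf
    obtain ⟨g', hg', hg⟩ := hg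
    refine ⟨⟨E.obj (n + 1), u.app (n + 1) ≫ f', v.app (n + 1) ≫ g'⟩, ⟨E.sector n, ?_, ?_⟩,
      ih hf hg⟩
    · rw [Sector.push_comp, u.comm, ← Sector.pull_push, hf', ← Sector.pull_comp]
    · rw [Sector.push_comp, v.comm, ← Sector.pull_push, hg', ← Sector.pull_comp]

/-- Two complexes represent the same element as soon as, for each `k`, some element is represented
near both of them up to degree `k`. Condition S1 turns the latter into spans truncated in degree
`k`, and König's lemma assembles these into one span of complexes. -/
theorem point_eq_of_isNear (hM : IsEquationalSystem M) (hS : SolvableS1 M) {a : A}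
    {C D : SectorComplex M} {h : C.obj 0 ⟶ a} {l : D.obj 0 ⟶ a}
    (H : ∀ k, ∃ x, IsNear k C h x ∧ IsNear k D l x) : point C h = point D l := by
  have := SectorComplex.finite_spanAt hM C D
  obtain ⟨s, h0, hs⟩ := exists_path_of_forall_hasPath
    (L := SectorComplex.SpanAt C D) SectorComplex.SpanStep
    (fun s => s.left ≫ h = s.right ≫ l) (fun k => by
      obtain ⟨x, ⟨C', f, e, hf⟩, ⟨D', g, e', hg⟩⟩ := H k
      obtain ⟨E, u, v, huv⟩ := exists_span_of_point_eq hM hS (e.trans e'.symm)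
      exact ⟨_, by simpa using huv, hasPath_spanStep u v hf hg⟩)
  obtain ⟨E, u, v, huv⟩ := SectorComplex.exists_span_of_steps s hs
  rw [← huv 0] at h0
  exact point_eq_of_span u v h0

/-- Complexes of length `n` starting at an object. -/
def Truncated (M : Profunctor.{u} A A) : ℕ → A → Type u
  | 0, _ => PUnit
  | n + 1, a => Σ p : (Σ b : A, Sector M b a), Truncated M n p.1

theorem finite_sectors (hM : IsEquationalSystem M) (a : A) : Finite (Σ b : A, Sector M b a) := by
  have := (hM.finite a).1
  exact Finite.of_surjective (fun q : (M.obj a).Elements => (⟨unop q.1, q.2⟩ : Σ b : A, Sector M b a))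
    (fun p => ⟨⟨op p.1, p.2⟩, rfl⟩)

theorem finite_truncated (hM : IsEquationalSystem M) (n : ℕ) (a : A) :
    Finite (Truncated M n a) := by
  induction n generalizing a with
  | zero => exact inferInstanceAs (Finite PUnit)
  | succ n ih =>
    have := finite_sectors hM a
    exact inferInstanceAs (Finite (Σ p : (Σ b : A, Sector M b a), Truncated M n p.1))

namespace Truncated

/-- Forget the last sector of a truncated complex. -/
def res : ∀ {n : ℕ} {a : A}, Truncated M (n + 1) a → Truncated M n a
  | 0, _, _ => PUnit.unit
  | _ + 1, _, ⟨p, t⟩ => ⟨p, res t⟩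

/-- The truncations of a complex. -/
def ofComplex : ∀ (n : ℕ) (C : SectorComplex M), Truncated M n (C.obj 0)
  | 0, _ => PUnit.unit
  | n + 1, C => ⟨⟨C.obj 1, C.sector 0⟩, ofComplex n C.shift⟩

theorem res_ofComplex (n : ℕ) (C : SectorComplex M) :
    res (ofComplex (n + 1) C) = ofComplex n C := by
  induction n generalizing C with
  | zero => rfl
  | succ n ih => exact congrArg (Sigma.mk _) (ih C.shift)

/-- A compatible sequence of truncated complexes starts with a sector, followed by another compatible
sequence. -/
theorem exists_head_tail {a : A} (t : ∀ n, Truncated M n a) (ht : ∀ n, res (t (n + 1)) = t n) :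
    ∃ (b : A) (m : Sector M b a) (s : ∀ n, Truncated M n b),
      (∀ n, res (s (n + 1)) = s n) ∧ ∀ n, t (n + 1) = ⟨⟨b, m⟩, s n⟩ := by
  obtain ⟨⟨b, m⟩, s₀, h0⟩ : ∃ p s, t 1 = ⟨p, s⟩ := ⟨_, _, rfl⟩
  have key : ∀ n, ∃ s : Truncated M n b, t (n + 1) = ⟨⟨b, m⟩, s⟩ := by
    intro n
    induction n with
    | zero => exact ⟨s₀, h0⟩
    | succ n ih =>
      obtain ⟨s, hs⟩ := ih
      obtain ⟨⟨b', m'⟩, s', h1⟩ : ∃ p s, t (n + 2) = ⟨p, s⟩ := ⟨_, _, rfl⟩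
      have h2 := ht (n + 1)
      rw [h1, hs] at h2
      have h3 : (⟨b', m'⟩ : Σ b : A, Sector M b a) = ⟨b, m⟩ := congrArg Sigma.fst h2
      cases h3
      exact ⟨s', h1⟩
  choose s hs using key
  refine ⟨b, m, s, fun n => ?_, hs⟩
  have h2 := ht (n + 1)
  rw [hs, hs] at h2
  exact eq_of_heq (Sigma.mk.inj h2).2

/-- Every compatible sequence of truncated complexes comes from a complex. -/
theorem exists_complex {a : A} (t : ∀ n, Truncated M n a) (ht : ∀ n, res (t (n + 1)) = t n) :
    ∃ C : SectorComplex M, ∀ n,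
      (⟨a, t n⟩ : Σ a : A, Truncated M n a) = ⟨C.obj 0, ofComplex n C⟩ := by
  choose b m s hs hts using fun x : Σ a : A, {t : ∀ n, Truncated M n a // ∀ n, res (t (n + 1)) = t n}
    => exists_head_tail x.2.1 x.2.2
  let C := SectorComplex.ofStep
    (S := Σ a : A, {t : ∀ n, Truncated M n a // ∀ n, res (t (n + 1)) = t n})
    (fun x => x.1) (fun x => ⟨b x, s x, hs x⟩) m
  have key : ∀ n x, x.2.1 n = ofComplex n (C x) := by
    intro n
    induction n with
    | zero => exact fun _ => rfl
    | succ n ih =>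
      intro x
      rw [hts x n]
      exact congrArg (Sigma.mk _) (ih ⟨b x, s x, hs x⟩)
  exact ⟨C ⟨a, t, ht⟩, fun n => congrArg (Sigma.mk a) (key n ⟨a, t, ht⟩)⟩

/-- The elements of a coalgebra that have a resolution starting with a given truncated complex. -/
def cylinder {X : A ⥤ Type u} (ξ : X ⟶ (modTensorSet M).obj X) :
    ∀ {n : ℕ} {a : A}, Truncated M n a → Set (X.obj a)
  | 0, _, _ => Set.univ
  | _ + 1, _, ⟨p, t⟩ => {x | ∃ y ∈ cylinder ξ t, unfoldElem ξ x = tmk p.2 y}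

variable {X : A ⥤ Type u} {ξ : X ⟶ (modTensorSet M).obj X}

theorem cylinder_subset_res {n : ℕ} {a : A} (t : Truncated M (n + 1) a) :
    cylinder ξ t ⊆ cylinder ξ (res t) := by
  induction n generalizing a with
  | zero => exact fun _ _ => trivial
  | succ n ih =>
    rintro x ⟨y, hy, e⟩
    exact ⟨y, ih _ hy, e⟩

theorem exists_mem_cylinder (ξ : X ⟶ (modTensorSet M).obj X) (n : ℕ) {a : A} (x : X.obj a) :
    ∃ t : Truncated M n a, x ∈ cylinder ξ t := by
  induction n generalizing a with
  | zero => exact ⟨PUnit.unit, trivial⟩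
  | succ n ih =>
    obtain ⟨b, m, y, e⟩ := exists_unfoldElem_eq ξ x
    obtain ⟨t, ht⟩ := ih y
    exact ⟨⟨⟨b, m⟩, t⟩, y, ht, e⟩

theorem map_mem_cylinder {X' : A ⥤ Type u} {ξ' : X' ⟶ (modTensorSet M).obj X'} {α : X ⟶ X'}
    (hα : ξ ≫ (modTensorSet M).map α = α ≫ ξ') {n : ℕ} {a : A} {t : Truncated M n a} {x : X.obj a}
    (hx : x ∈ cylinder ξ t) : α.app a x ∈ cylinder ξ' t := by
  induction n generalizing a with
  | zero => trivial
  | succ n ih =>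
    obtain ⟨y, hy, e⟩ := hx
    exact ⟨α.app _ y, ih hy, unfoldElem_hom hα e⟩

theorem hasPath_mapStep_shift {D C : SectorComplex M} {k n : ℕ}
    {f : D.obj (n + 1) ⟶ C.obj (n + 1)}
    (h : HasPath (MapStep (D := D.shift) (C := C.shift)) k n f) :
    HasPath (MapStep (D := D) (C := C)) k (n + 1) f := by
  induction k generalizing n with
  | zero => trivial
  | succ k ih =>
    obtain ⟨g, hg, h⟩ := h
    exact ⟨g, hg, ih h⟩

theorem isNear_of_mem_cylinder {n : ℕ} {C : SectorComplex M} {x : (solution M).obj (C.obj 0)}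
    (hx : x ∈ cylinder (solutionStr M) (ofComplex n C)) : IsNear n C (𝟙 _) x := by
  induction n generalizing C with
  | zero =>
    induction x using point_ind with
    | h D h => exact ⟨D, h, by rw [Category.comp_id], trivial⟩
  | succ n ih =>
    obtain ⟨y, hy, e⟩ := hx
    obtain ⟨D, f, rfl, hf⟩ := ih hy
    obtain rfl := eq_prefixMap_of_unfoldElem_eq e
    refine ⟨D.cons (Sector.pull (f ≫ 𝟙 _) (C.sector 0)), 𝟙 _, ?_, f, ?_, ?_⟩
    · exact congrArg (point _) (Category.id_comp _)
    · exact (Sector.push_id _).trans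
        (congrArg (fun k => Sector.pull k (C.sector 0)) (Category.comp_id f))
    · exact hasPath_mapStep_shift (D := D.cons (Sector.pull (f ≫ 𝟙 _) (C.sector 0))) hf

theorem point_mem_cylinder (C : SectorComplex M) (n : ℕ) :
    point C (𝟙 _) ∈ cylinder (solutionStr M) (ofComplex n C) := by
  induction n generalizing C with
  | zero => trivial
  | succ n ih =>
    refine ⟨point C.shift (𝟙 _), ih C.shift, ?_⟩
    rw [unfoldElem_point, Sector.push_id]

theorem exists_point_of_compatible {a : A} (t : ∀ n, Truncated M n a)
    (ht : ∀ n, res (t (n + 1)) = t n) :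
    ∃ (C : SectorComplex M) (h : C.obj 0 ⟶ a),
      (∀ n, point C h ∈ cylinder (solutionStr M) (t n)) ∧
      ∀ n x, x ∈ cylinder (solutionStr M) (t n) → IsNear n C h x := by
  obtain ⟨C, hC⟩ := exists_complex t ht
  have ha : a = C.obj 0 := congrArg Sigma.fst (hC 0)
  subst ha
  have hC' : ∀ n, t n = ofComplex n C := fun n => eq_of_heq (Sigma.mk.inj (hC n)).2
  obtain rfl : t = fun n => ofComplex n C := funext hC'
  exact ⟨C, 𝟙 _, point_mem_cylinder C, fun n x => isNear_of_mem_cylinder⟩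

/-- Cylinders separate points: elements lying in all cylinders of two compatible sequences of
truncated complexes agree if the cylinders of each length meet. -/
theorem eq_of_cylinders_meet (hM : IsEquationalSystem M) (hS : SolvableS1 M) {a : A}
    {t s : ∀ n, Truncated M n a} (ht : ∀ n, res (t (n + 1)) = t n)
    (hs : ∀ n, res (s (n + 1)) = s n)
    (H : ∀ n, (cylinder (solutionStr M) (t n) ∩ cylinder (solutionStr M) (s n)).Nonempty)
    {x y : (solution M).obj a} (hx : ∀ n, x ∈ cylinder (solutionStr M) (t n))
    (hy : ∀ n, y ∈ cylinder (solutionStr M) (s n)) : x = y := by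
  obtain ⟨C, h, -, hC⟩ := exists_point_of_compatible t ht
  obtain ⟨D, k, -, hD⟩ := exists_point_of_compatible s hs
  have hCD : point C h = point D k := point_eq_of_isNear hM hS fun n => by
    obtain ⟨z, hz, hz'⟩ := H n
    exact ⟨z, hC n z hz, hD n z hz'⟩
  have hxC : x = point C h := by
    induction x using point_ind with
    | h E l => exact point_eq_of_isNear hM hS fun n => ⟨_, isNear_point n E l, hC n _ (hx n)⟩
  have hyD : y = point D k := by
    induction y using point_ind with
    | h E l => exact point_eq_of_isNear hM hS fun n => ⟨_, isNear_point n E l, hD n _ (hy n)⟩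
  rw [hxC, hCD, hyD]

end Truncated

theorem IsResolution.mem_cylinder {X : A ⥤ Type u} {ξ : X ⟶ (modTensorSet M).obj X}
    {C : SectorComplex M} {x : ∀ n, X.obj (C.obj n)} (h : IsResolution ξ C x) (n : ℕ) :
    x 0 ∈ Truncated.cylinder ξ (Truncated.ofComplex n C) := by
  induction n generalizing C with
  | zero => trivial
  | succ n ih => exact ⟨x 1, ih h.tail, h 0⟩

/-- Coalgebra maps into the universal solution are unique, since resolutions are preserved by
coalgebra maps and determine points of the universal solution. -/
theorem hom_solution_ext (hM : IsEquationalSystem M) (hS : SolvableS1 M) {X : A ⥤ Type u}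
    {ξ : X ⟶ (modTensorSet M).obj X} {α β : X ⟶ solution M}
    (hα : ξ ≫ (modTensorSet M).map α = α ≫ solutionStr M)
    (hβ : ξ ≫ (modTensorSet M).map β = β ≫ solutionStr M) : α = β := by
  ext a x
  obtain ⟨C, h, y, hy, rfl⟩ := exists_resolution ξ x
  have e : α.app _ (y 0) = β.app _ (y 0) :=
    Truncated.eq_of_cylinders_meet hM hS (t := fun n => Truncated.ofComplex n C)
      (s := fun n => Truncated.ofComplex n C) (fun n => Truncated.res_ofComplex n C)
      (fun n => Truncated.res_ofComplex n C)
      (fun n => ⟨α.app _ (y 0), Truncated.map_mem_cylinder hα (hy.mem_cylinder n),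
        Truncated.map_mem_cylinder hα (hy.mem_cylinder n)⟩)
      (fun n => Truncated.map_mem_cylinder hα (hy.mem_cylinder n))
      (fun n => Truncated.map_mem_cylinder hβ (hy.mem_cylinder n))
  exact (NatTrans.naturality_apply α h (y 0)).trans
    ((congrArg ((solution M).map h) e).trans (NatTrans.naturality_apply β h (y 0)).symm)

end Cylinders

/-! ### The topology of the universal solution -/

section Topology

variable {A : Type u} [SmallCategory A] {M : Profunctor.{u} A A}

open Truncated

/-- `S` is `n`-near to `x` when some cylinder of length `n` contains `x` and meets `S`. -/
def MeetsCylinder {a : A} (S : Set ((solution M).obj a)) (n : ℕ) (x : (solution M).obj a) : Prop :=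
  ∃ t : Truncated M n a, x ∈ cylinder (solutionStr M) t ∧ (cylinder (solutionStr M) t ∩ S).Nonempty

theorem MeetsCylinder.mono {a : A} {S T : Set ((solution M).obj a)} (hST : S ⊆ T) {n : ℕ}
    {x : (solution M).obj a} (h : MeetsCylinder S n x) : MeetsCylinder T n x := by
  obtain ⟨t, ht, y, hy, hyS⟩ := h
  exact ⟨t, ht, y, hy, hST hyS⟩

theorem MeetsCylinder.anti {a : A} {S : Set ((solution M).obj a)} {k n : ℕ} (hkn : k ≤ n)
    {x : (solution M).obj a} (h : MeetsCylinder S n x) : MeetsCylinder S k x := by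
  induction n, hkn using Nat.le_induction with
  | base => exact h
  | succ n _ ih =>
    obtain ⟨t, ht, y, hy, hyS⟩ := h
    exact ih ⟨res t, cylinder_subset_res t ht, y, cylinder_subset_res t hy, hyS⟩

/-- The topology on `I(a)` in which a point lies in the closure of a set `S` when, for every `n`,
some cylinder of length `n` contains the point and meets `S`. -/
@[reducible]
def solutionTopology (M : Profunctor.{u} A A) (a : A) : TopologicalSpace ((solution M).obj a) :=
  TopologicalSpace.ofClosed {S | ∀ x, (∀ n, MeetsCylinder S n x) → x ∈ S}
    (fun x hx => by
      obtain ⟨_, _, _, _, h⟩ := hx 0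
      exact h)
    (fun F hF x hx S hS => hF hS x fun n => (hx n).mono (Set.sInter_subset_of_mem hS))
    (fun S hS T hT x hx => by
      by_contra hx'
      obtain ⟨hxS, hxT⟩ := not_or.1 hx'
      obtain ⟨k, hk⟩ := not_forall.1 fun h => hxS (hS x h)
      obtain ⟨l, hl⟩ := not_forall.1 fun h => hxT (hT x h)
      obtain ⟨t, ht, y, hy, hyST⟩ := hx (max k l)
      rcases hyST with hyS | hyT
      · exact hk (MeetsCylinder.anti (le_max_left k l) ⟨t, ht, y, hy, hyS⟩)
      · exact hl (MeetsCylinder.anti (le_max_right k l) ⟨t, ht, y, hy, hyT⟩))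

attribute [local instance] solutionTopology

theorem isClosed_solution_iff {a : A} {S : Set ((solution M).obj a)} :
    IsClosed S ↔ ∀ x, (∀ n, MeetsCylinder S n x) → x ∈ S := by
  rw [← isOpen_compl_iff]
  change Sᶜᶜ ∈ {S : Set ((solution M).obj a) | ∀ x, (∀ n, MeetsCylinder S n x) → x ∈ S} ↔ _
  rw [compl_compl]
  rfl

/-- `CarriesCylinders φ` means that `φ` maps cylinders into cylinders of the same length,
compatibly with truncation. -/
def CarriesCylinders {a b : A} (φ : (solution M).obj b → (solution M).obj a) : Prop :=
  ∃ T : ∀ n, Truncated M n b → Truncated M n a, (∀ n t, res (T (n + 1) t) = T n (res t)) ∧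
    ∀ n t, ∀ x ∈ cylinder (solutionStr M) t, φ x ∈ cylinder (solutionStr M) (T n t)

theorem CarriesCylinders.continuous {a b : A} {φ : (solution M).obj b → (solution M).obj a}
    (hφ : CarriesCylinders φ) : Continuous φ := by
  obtain ⟨T, -, hT⟩ := hφ
  refine continuous_iff_isClosed.2 fun S hS => isClosed_solution_iff.2 fun x hx => ?_
  refine isClosed_solution_iff.1 hS _ fun n => ?_
  obtain ⟨t, ht, y, hy, hyS⟩ := hx n
  exact ⟨T n t, hT n t x ht, φ y, hT n t y hy, hyS⟩

/-- Closedness is a compactness argument: the cylinders witnessing that `y` is in the closure of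
`φ(S)`, together with cylinders around the points of `S` concerned, have compatible choices for all
lengths by König's lemma, and the latter converge to a point of `S` which `φ` sends to `y`. -/
theorem CarriesCylinders.isClosedMap (hM : IsEquationalSystem M) (hS : SolvableS1 M) {a b : A}
    {φ : (solution M).obj b → (solution M).obj a} (hφ : CarriesCylinders φ) : IsClosedMap φ := by
  obtain ⟨T, hTres, hT⟩ := hφ
  refine fun S hSc => isClosed_solution_iff.2 fun y hy => ?_
  let ξ := solutionStr M
  let L : ℕ → Type u := fun n =>
    {p : Truncated M n a × Truncated M n b // y ∈ cylinder ξ p.1 ∧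
      ∃ x ∈ S, x ∈ cylinder ξ p.2 ∧ φ x ∈ cylinder ξ p.1}
  let R : ∀ n, L n → L (n + 1) → Prop := fun n p q => res q.1.1 = p.1.1 ∧ res q.1.2 = p.1.2
  have : ∀ n, Nonempty (L n) := fun n => by
    obtain ⟨t, ht, _, hxt, x, hx, rfl⟩ := hy n
    obtain ⟨s, hs⟩ := exists_mem_cylinder ξ n x
    exact ⟨⟨(t, s), ht, x, hx, hs, hxt⟩⟩
  have : ∀ n, Finite (L (n + 1)) := fun n => by
    have := finite_truncated hM (n + 1) a
    have := finite_truncated hM (n + 1) b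
    infer_instance
  have hR : ∀ n q, ∃ p, R n p q := by
    rintro n ⟨⟨t, s⟩, ht, x, hx, hs, hxt⟩
    exact ⟨⟨(res t, res s), cylinder_subset_res t ht, x, hx, cylinder_subset_res s hs,
      cylinder_subset_res t hxt⟩, rfl, rfl⟩
  obtain ⟨p, -, hp⟩ := exists_path_of_forall_hasPath R (fun _ => True)
    (fun k => (exists_hasPath_of_pred R hR k 0).imp fun _ h => ⟨trivial, h⟩)
  obtain ⟨C, h, hC, -⟩ := exists_point_of_compatible (fun n => (p n).1.2) fun n => (hp n).2
  refine ⟨point C h, isClosed_solution_iff.1 hSc _ fun n => ?_, ?_⟩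
  · obtain ⟨-, x, hx, hxs, -⟩ := (p n).2
    exact ⟨(p n).1.2, hC n, x, hxs, hx⟩
  · refine eq_of_cylinders_meet hM hS (t := fun n => T n (p n).1.2) (s := fun n => (p n).1.1)
      (fun n => ?_) (fun n => (hp n).1) (fun n => ?_) (fun n => hT n _ _ (hC n))
      (fun n => (p n).2.1)
    · rw [hTres, (hp n).2]
    · obtain ⟨-, x, -, hxs, hxt⟩ := (p n).2
      exact ⟨φ x, hT n _ _ hxs, hxt⟩

theorem carriesCylinders_map {a a' : A} (f : a ⟶ a') :
    CarriesCylinders ((solution M).map f) := by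
  refine ⟨fun n => match n with
    | 0 => fun _ => PUnit.unit
    | _ + 1 => fun t => ⟨⟨t.1.1, t.1.2.push f⟩, t.2⟩, ?_, ?_⟩
  · rintro (_ | n) ⟨⟨b, m⟩, t⟩ <;> rfl
  · rintro (_ | n) t x hx
    · trivial
    · obtain ⟨y, hy, e⟩ := hx
      exact ⟨y, hy, unfoldElem_map _ f e⟩

theorem carriesCylinders_prefixMap {b a : A} (m : Sector M b a) :
    CarriesCylinders (prefixMap m) := by
  refine ⟨fun n => match n with
    | 0 => fun _ => PUnit.unit
    | _ + 1 => fun t => ⟨⟨b, m⟩, res t⟩, ?_, ?_⟩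
  · rintro (_ | n) t <;> rfl
  · rintro (_ | n) t x hx
    · trivial
    · exact ⟨x, cylinder_subset_res t hx, unfoldElem_prefixMap m x⟩

/-- The universal solution as a functor to spaces. -/
def solutionTop (M : Profunctor.{u} A A) : A ⥤ TopCat.{u} where
  obj a := TopCat.of ((solution M).obj a)
  map f := TopCat.ofHom ⟨(solution M).map f, (carriesCylinders_map f).continuous⟩
  map_id a := by
    ext x
    exact congrArg (fun k => k x) ((solution M).map_id a)
  map_comp f g := by
    ext x
    exact congrArg (fun k => k x) ((solution M).map_comp f g)

theorem isClosed_tensor_iff {Y : Aᵒᵖ ⥤ Type u} {X : A ⥤ TopCat.{u}}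
    {K : Set (Tensor Y (underlying X))} :
    IsClosed K ↔ ∀ (b : A) (y : Y.obj (op b)),
      IsClosed {x : X.obj b | (tmk (X := underlying X) y x : Tensor Y (underlying X)) ∈ K} := by
  refine ⟨fun hK b y => hK.preimage (continuous_tmk y), fun h => ?_⟩
  refine ((isQuotientMap_quot_mk (X := TensorSum Y (underlying X))).isClosed_preimage).1 ?_
  exact (isClosed_sigma_iff (σ := fun p : (Σ b : A, Y.obj (op b)) => (X.obj p.1 : Type u))).2
    fun p => h p.1 p.2

/-- The structure map of the universal solution is continuous, because the preimage of a closed set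
is a finite union of images of closed sets under the closed maps `prefixMap m`. -/
theorem continuous_unfoldElem (hM : IsEquationalSystem M) (hS : SolvableS1 M) (a : A) :
    Continuous (X := (solution M).obj a) (Y := Tensor (M.obj a) (underlying (solutionTop M)))
      (unfoldElem (solutionStr M)) := by
  refine continuous_iff_isClosed.2 fun K hK => ?_
  have := finite_sectors hM a
  have hK' := isClosed_tensor_iff.1 hK
  have : unfoldElem (solutionStr M) ⁻¹' K = ⋃ p : (Σ b : A, Sector M b a),
      prefixMap p.2 '' {x | (tmk p.2 x : Tensor (M.obj a) (solution M)) ∈ K} := by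
    ext x
    simp only [Set.mem_iUnion, Set.mem_image, Set.mem_ofPred_eq]
    constructor
    · intro hx
      obtain ⟨b, m, y, e⟩ := exists_unfoldElem_eq (solutionStr M) x
      exact ⟨⟨b, m⟩, y, e ▸ hx, (eq_prefixMap_of_unfoldElem_eq e).symm⟩
    · rintro ⟨p, y, hy, rfl⟩
      exact (congrArg (· ∈ K) (unfoldElem_prefixMap p.2 y)).mpr hy
  refine (congrArg IsClosed this).mpr ?_
  exact isClosed_iUnion_of_finite fun p =>
    (carriesCylinders_prefixMap p.2).isClosedMap hM hS _ (hK' p.1 p.2)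

/-- The structure map `I ⟶ M ⊗ I` in spaces. -/
def solutionStrTop (hM : IsEquationalSystem M) (hS : SolvableS1 M) :
    solutionTop M ⟶ (modTensorTop M).obj (solutionTop M) where
  app a := TopCat.ofHom (Y := Tensor (M.obj a) (underlying (solutionTop M)))
    ⟨_, continuous_unfoldElem hM hS a⟩
  naturality a a' f := by
    ext x
    exact NatTrans.naturality_apply (solutionStr M) f x

/-- For a presheaf with finite category of elements, the maps `y ⊗ -` are closed: points of `X(b')`
identified with points of a given subset of `X(b)` are obtained by means of the finitely many
spans `(g, g')` with `y' g = y g'`. -/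
theorem isClosedMap_tmk {X : A ⥤ TopCat.{u}} (hX : NondegenerateTop X) {Y : Aᵒᵖ ⥤ Type u}
    (hY : FinitePresheaf Y) {b : A} (y : Y.obj (op b)) :
    IsClosedMap (fun x : X.obj b => (tmk (X := underlying X) y x : Tensor Y (underlying X))) := by
  intro K hK
  refine isClosed_tensor_iff.2 fun b' y' => ?_
  obtain ⟨h1, h2⟩ := hY
  let p : Y.Elements := ⟨op b, y⟩
  let p' : Y.Elements := ⟨op b', y'⟩
  have : ∀ r, Finite ((p' ⟶ r) × (p ⟶ r)) := fun r => inferInstance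
  have e : {x : X.obj b' | (tmk (X := underlying X) y' x : Tensor Y (underlying X)) ∈
      (fun x : X.obj b => (tmk (X := underlying X) y x : Tensor Y (underlying X))) '' K} =
      ⋃ q : (Σ r : Y.Elements, (p' ⟶ r) × (p ⟶ r)),
        X.map q.2.1.1.unop '' (X.map q.2.2.1.unop ⁻¹' K) := by
    ext x'
    simp only [Set.mem_ofPred_eq, Set.mem_image, Set.mem_iUnion, Set.mem_preimage]
    constructor
    · rintro ⟨x, hx, e⟩
      obtain ⟨c, g, g', z, rfl, rfl, hg⟩ := (hX.1.isComponentwiseFlat.tmk_eq_iff _ _ _ _).1 e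
      exact ⟨⟨⟨op c, Y.map g.op y⟩, ⟨g'.op, hg.symm⟩, ⟨g.op, rfl⟩⟩, z, hx, rfl⟩
    · rintro ⟨⟨⟨c, w⟩, ⟨g', hg'⟩, ⟨g, hg⟩⟩, z, hz, rfl⟩
      refine ⟨_, hz, ?_⟩
      have := (tmk_glue (X := underlying X) g.unop y z).symm.trans
        ((congrArg (fun k => (tmk k z : Tensor Y (underlying X))) (hg.trans hg'.symm)).trans
          (tmk_glue (X := underlying X) g'.unop y' z))
      exact this
  rw [e]
  exact isClosed_iUnion_of_finite fun q =>
    hX.2 _ _ (hK.preimage (X.map q.2.2.1.unop).hom.continuous)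

/-- The structure map of the underlying coalgebra in `Set` of a coalgebra in `Top`. -/
abbrev underlyingStr {X : A ⥤ TopCat.{u}} (ξ : X ⟶ (modTensorTop M).obj X) :
    underlying X ⟶ (modTensorSet M).obj (underlying X) :=
  Functor.whiskerRight ξ (forget TopCat.{u}) ≫ (underlyingModTensor M X).hom

theorem isClosed_cylinder (hM : IsEquationalSystem M) {X : A ⥤ TopCat.{u}}
    (hX : NondegenerateTop X) (ξ : X ⟶ (modTensorTop M).obj X) {n : ℕ} {a : A}
    (t : Truncated M n a) : IsClosed (X := X.obj a) (cylinder (underlyingStr ξ) t) := by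
  induction n generalizing a with
  | zero => exact isClosed_univ
  | succ n ih =>
    obtain ⟨⟨b, m⟩, t⟩ := t
    have h1 := isClosedMap_tmk hX (hM.finite a) m _ (ih t)
    have h2 := h1.preimage (ξ.app a).hom.continuous
    convert h2 using 1
    ext x
    constructor
    · rintro ⟨y, hy, e⟩
      exact ⟨y, hy, e.symm⟩
    · rintro ⟨y, hy, e⟩
      exact ⟨y, hy, e.symm⟩

/-- A map from a coalgebra in `Top` to the universal solution is continuous: the preimage of a closed
set is an intersection of finite unions of cylinders. -/
theorem continuous_classify (hM : IsEquationalSystem M) {X : A ⥤ TopCat.{u}}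
    (hX : NondegenerateTop X) (ξ : X ⟶ (modTensorTop M).obj X) (a : A) :
    Continuous (X := X.obj a) (Y := (solution M).obj a) (classify (underlyingStr ξ)) := by
  have hX' := hX.1.isComponentwiseFlat
  have hcyl : ∀ {n : ℕ} {t : Truncated M n a} {x : X.obj a},
      x ∈ cylinder (underlyingStr ξ) t →
        classify (underlyingStr ξ) x ∈ cylinder (solutionStr M) t := fun h =>
    map_mem_cylinder (classifyHom_comm hX' (underlyingStr ξ)) h
  refine continuous_iff_isClosed.2 fun S hS => ?_
  have : classify (underlyingStr ξ) ⁻¹' S = ⋂ n : ℕ,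
      ⋃ t : {t : Truncated M n a // (cylinder (solutionStr M) t ∩ S).Nonempty},
        cylinder (underlyingStr ξ) t.1 := by
    ext x
    simp only [Set.mem_preimage, Set.mem_iInter, Set.mem_iUnion]
    constructor
    · intro hx n
      obtain ⟨t, ht⟩ := exists_mem_cylinder (underlyingStr ξ) n x
      exact ⟨⟨t, _, hcyl ht, hx⟩, ht⟩
    · intro h
      refine isClosed_solution_iff.1 hS _ fun n => ?_
      obtain ⟨⟨t, ht⟩, hx⟩ := h n
      exact ⟨t, hcyl hx, ht⟩
  rw [this]
  refine isClosed_iInter fun n => ?_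
  have := finite_truncated hM n a
  exact isClosed_iUnion_of_finite fun t => isClosed_cylinder hM hX ξ t.1

/-- The universal solution as a coalgebra in `Top`. -/
def solutionCoalgTop (hM : IsEquationalSystem M) (hS : Solvable M) : CoalgTop M where
  obj := { V := solutionTop M, str := solutionStrTop hM hS.1 }
  property := ⟨(isComponentwiseFlat_solution hM hS).nondegenerateSet,
    fun _ _ f => (carriesCylinders_map f).isClosedMap hM hS.1⟩

theorem hasUniversalSolutionTop_of_solvable (hM : IsEquationalSystem M) (hS : Solvable M) :
    HasUniversalSolutionTop M := by
  refine ⟨solutionCoalgTop hM hS, ⟨IsTerminal.ofUniqueHom (fun C => ObjectProperty.homMk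
    { f :=
        { app := fun a => TopCat.ofHom
            ⟨_, continuous_classify hM C.property C.obj.str a⟩
          naturality := fun a a' f => ?_ }
      h := ?_ }) ?_⟩⟩
  · ext x
    exact NatTrans.naturality_apply
      (classifyHom C.property.1.isComponentwiseFlat (underlyingStr C.obj.str)) f x
  · ext a x
    exact congrArg (fun k => k.app a x)
      (classifyHom_comm C.property.1.isComponentwiseFlat (underlyingStr C.obj.str))
  · intro C m
    have := hom_solution_ext hM hS.1 ((forgetCoalg M).map m).hom.h
      (classifyHom_comm C.property.1.isComponentwiseFlat (underlyingStr C.obj.str))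
    ext a x
    exact congrArg (fun k => k.app a x) this

end Topology

/-! ### Universal solutions in `Top` and in `Set` -/

section Comparison

variable {A : Type u} [SmallCategory A] {M : Profunctor.{u} A A}

/-- A coalgebra in `Set`, with discrete topologies. -/
def discreteCoalg (C : CoalgSet M) : CoalgTop M where
  obj :=
    { V := C.obj.V ⋙ TopCat.discrete
      str :=
        { app := fun a => TopCat.ofHom (X := (TopCat.discrete.obj (C.obj.V.obj a) : Type u))
            (Y := Tensor (M.obj a) (underlying (C.obj.V ⋙ TopCat.discrete)))
            ⟨unfoldElem C.obj.str, continuous_bot⟩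
          naturality := fun a a' f => by
            ext x
            exact NatTrans.naturality_apply C.obj.str f x } }
  property := ⟨C.property, fun _ a' _ _ _ =>
    isClosed_discrete (α := (TopCat.discrete.obj (C.obj.V.obj a') : Type u)) _⟩

/-- A coalgebra map from `C` to the underlying coalgebra of `D` is continuous for the discrete
topologies on `C`. -/
def discreteLift {C : CoalgSet M} {D : CoalgTop M} (m : C ⟶ (forgetCoalg M).obj D) :
    discreteCoalg C ⟶ D :=
  ObjectProperty.homMk
    { f :=
        { app := fun a => TopCat.ofHom (X := (TopCat.discrete.obj (C.obj.V.obj a) : Type u))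
            ⟨m.hom.f.app a, continuous_bot⟩
          naturality := fun a a' f => by
            ext x
            exact NatTrans.naturality_apply m.hom.f f x }
      h := by
        ext a x
        exact congrArg (fun k => k.app a x) m.hom.h }

/-- The underlying coalgebra functor preserves terminal objects, being right adjoint to
`discreteCoalg`. -/
def isTerminalForgetCoalg {I : CoalgTop M} (hI : IsTerminal I) :
    IsTerminal ((forgetCoalg M).obj I) :=
  IsTerminal.ofUniqueHom (fun C => (forgetCoalg M).map (hI.from (discreteCoalg C)))
    fun C m => by
      have := hI.hom_ext (discreteLift m) (hI.from (discreteCoalg C))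
      rw [← this]
      rfl

end Comparison

/-! ### Necessity of condition S -/

section Necessity

variable {A : Type u} [SmallCategory A] {M : Profunctor.{u} A A}

/-- The sum `∑ₙ A(Cₙ, -)` of representables attached to a complex `C`. -/
def representableSum (C : SectorComplex M) : A ⥤ Type u where
  obj a := Σ n : ℕ, (C.obj n ⟶ a)
  map f := TypeCat.ofHom fun p => ⟨p.1, p.2 ≫ f⟩

/-- The element of `∑ₙ A(Cₙ, -)` given by a map out of `Cₙ`. -/
def representableSumMk {C : SectorComplex M} {a : A} (n : ℕ) (h : C.obj n ⟶ a) :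
    (representableSum C).obj a :=
  ⟨n, h⟩

theorem isComponentwiseFlat_representableSum (C : SectorComplex M) :
    IsComponentwiseFlat (representableSum C) where
  square := by
    rintro a a' b f f' ⟨n, h⟩ ⟨n', h'⟩ e
    obtain rfl : n = n' := congrArg Sigma.fst e
    exact ⟨C.obj n, h, h', ⟨n, 𝟙 _⟩, eq_of_heq (Sigma.mk.inj e).2,
      congrArg (Sigma.mk n) (Category.id_comp h), congrArg (Sigma.mk n) (Category.id_comp h')⟩
  fork := by
    rintro a b f f' ⟨n, h⟩ e
    exact ⟨C.obj n, h, ⟨n, 𝟙 _⟩, eq_of_heq (Sigma.mk.inj e).2,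
      congrArg (Sigma.mk n) (Category.id_comp h)⟩

/-- The coalgebra on `∑ₙ A(Cₙ, -)` which sends the generator in degree `n` to `mₙ₊₁` tensored with
the generator in degree `n + 1`. -/
def complexCoalg (C : SectorComplex M) : CoalgSet M where
  obj :=
    { V := representableSum C
      str :=
        { app := fun a => TypeCat.ofHom fun p =>
            (tmk ((C.sector p.1).push p.2) (representableSumMk (p.1 + 1) (𝟙 _)) :
              Tensor (M.obj a) (representableSum C))
          naturality := fun a a' f => by
            ext p
            change (tmk ((C.sector p.1).push (p.2 ≫ f)) _ : Tensor (M.obj a') (representableSum C))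
              = tmk (((C.sector p.1).push p.2).push f) _
            rw [Sector.push_comp]
            rfl } }
  property := (isComponentwiseFlat_representableSum C).nondegenerateSet

/-- A map of complexes `C ⟶ D` induces a coalgebra map in the opposite direction. -/
def complexCoalgMap {C D : SectorComplex M} (f : C.Map D) : complexCoalg D ⟶ complexCoalg C :=
  ObjectProperty.homMk
    { f :=
        { app := fun a => TypeCat.ofHom fun p =>
            representableSumMk p.1 (f.app p.1 ≫ p.2)
          naturality := fun a a' g => by
            ext p
            exact congrArg (Sigma.mk p.1) (Category.assoc _ _ _).symm }
      h := by
        ext a p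
        obtain ⟨n, h⟩ := p
        change (tmk ((D.sector n).push h) (representableSumMk (n + 1) (f.app (n + 1) ≫ 𝟙 _)) :
          Tensor (M.obj a) (representableSum C))
          = tmk ((C.sector n).push (f.app n ≫ h)) (representableSumMk (n + 1) (𝟙 _))
        rw [Sector.push_comp, f.comm, ← Sector.pull_push]
        refine Eq.trans ?_ (tmk_glue (f.app (n + 1)) ((D.sector n).push h) _).symm
        refine congrArg (tmk _) (congrArg (Sigma.mk (n + 1)) ?_)
        exact (Category.comp_id _).trans (Category.id_comp _).symm }

/-- The element of a terminal coalgebra determined by a complex: the image of the generator in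
degree `0`. -/
def terminalPoint {J : CoalgSet M} (hJ : IsTerminal J) (C : SectorComplex M) :
    J.obj.V.obj (C.obj 0) :=
  (hJ.from (complexCoalg C)).hom.f.app (C.obj 0)
    (representableSumMk (C := C) 0 (𝟙 (C.obj 0)))

theorem map_terminalPoint {J : CoalgSet M} (hJ : IsTerminal J) {C D : SectorComplex M}
    (f : C.Map D) : J.obj.V.map (f.app 0) (terminalPoint hJ C) = terminalPoint hJ D := by
  have h1 := NatTrans.naturality_apply (hJ.from (complexCoalg C)).hom.f (f.app 0)
    (representableSumMk (C := C) 0 (𝟙 (C.obj 0)))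
  have h2 : complexCoalgMap f ≫ hJ.from (complexCoalg C) = hJ.from (complexCoalg D) :=
    hJ.hom_ext _ _
  have h3 := congrArg (fun k => k.hom.f.app (D.obj 0)
    (representableSumMk (C := D) 0 (𝟙 (D.obj 0)))) h2
  refine h1.symm.trans (Eq.trans ?_ h3)
  refine congrArg ((hJ.from (complexCoalg C)).hom.f.app (D.obj 0)) ?_
  exact congrArg (Sigma.mk 0) ((Category.id_comp _).trans (Category.comp_id _).symm)

theorem solvable_of_hasUniversalSolutionSet (h : HasUniversalSolutionSet M) : Solvable M := by
  obtain ⟨J, ⟨hJ⟩⟩ := h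
  have hflat := J.property.isComponentwiseFlat
  constructor
  · intro C C' D f f'
    obtain ⟨c, g, g', -, e, -⟩ := hflat.square (f.app 0) (f'.app 0) (terminalPoint hJ C)
      (terminalPoint hJ C') (by rw [map_terminalPoint, map_terminalPoint])
    exact ⟨c, g, g', e⟩
  · intro C D f f'
    obtain ⟨c, g, -, e, -⟩ := hflat.fork (f.app 0) (f'.app 0) (terminalPoint hJ C)
      (by rw [map_terminalPoint, map_terminalPoint])
    exact ⟨c, g, e⟩

end Necessity

end SelfSimilarity

theorem theorem9p1 {A : Type u} [CategoryTheory.SmallCategory A]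
    (M : CategoryTheory.Profunctor.{u} A A) (hM : SelfSimilarity.IsEquationalSystem M) :
    [SelfSimilarity.Solvable M,
      SelfSimilarity.HasUniversalSolutionTop M,
      SelfSimilarity.HasUniversalSolutionSet M].TFAE ∧
    ∀ I : SelfSimilarity.CoalgTop M, CategoryTheory.Limits.IsTerminal I →
      Nonempty (CategoryTheory.Limits.IsTerminal ((SelfSimilarity.forgetCoalg M).obj I)) := by
  refine ⟨?_, fun I hI => ⟨SelfSimilarity.isTerminalForgetCoalg hI⟩⟩
  tfae_have 1 → 2 := SelfSimilarity.hasUniversalSolutionTop_of_solvable hM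
  tfae_have 2 → 3 := fun ⟨I, ⟨hI⟩⟩ => ⟨_, ⟨SelfSimilarity.isTerminalForgetCoalg hI⟩⟩
  tfae_have 3 → 1 := SelfSimilarity.solvable_of_hasUniversalSolutionSet
  tfae_finish
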